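/- Graphs are finite and may have loops and multiple edges. The degree of a vertex is the number of half-edges at it, so a loop counts twice. A graph is planar if it can be drawn in the plane without self-intersections: the vertices are represented by distinct points and each edge by a polygonal line joining the points of its ends (a closed polygonal line if the edge is a loop), so that no edge meets itself or another edge or a vertex except at its own ends. An Euler cycle of a graph is a closed walk that passes along every edge exactly once. In a graph all of whose vertices have degree $4$, an Euler cycle visits every vertex exactly twice; two distinct vertices $P$ and $Q$ are called interlaced with respect to the cycle if they occur along it in the cyclic order $PQPQ$ (and not $PPQQ$). An Euler cycle is called convenient if the vertices of the graph can be split into two disjoint sets (one of which may be empty) so that no two vertices of the same set are interlaced. Theorem. Let $G$ be a connected (in particular, non-empty) finite graph in which every vertex has degree $4$. Then $G$ is planar if and only if $G$ has a convenient Euler cycle. -/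

import Mathlib

noncomputable section

namespace Graph

variable {α β : Type*}

/-- The degree of the vertex `x` in a multigraph with finitely many edges: the number of
half-edges at `x`, so every loop at `x` counts twice. -/
def degree (G : Graph α β) (x : α) : ℕ :=
  {e | G.IsNonloopAt e x}.ncard + 2 * {e | G.IsLoopAt e x}.ncard

/-- A graph is connected if it has a vertex and any two of its vertices are joined by a walk. -/
def IsConnected (G : Graph α β) : Prop :=
  G.vertexSet.Nonempty ∧
    ∀ x ∈ G.vertexSet, ∀ y ∈ G.vertexSet, Relation.ReflTransGen G.Adj x y

/-! ### Plane drawings -/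

/-- The polygonal line with successive break points `q 0, q 1, q 2, …`: the map that runs
affinely along the segment from `q k` to `q (k + 1)` while `t` runs from `k` to `k + 1`. -/
def polyline (q : ℕ → EuclideanSpace ℝ (Fin 2)) (t : ℝ) : EuclideanSpace ℝ (Fin 2) :=
  AffineMap.lineMap (q ⌊t⌋₊) (q (⌊t⌋₊ + 1)) (t - (⌊t⌋₊ : ℝ))

/-- A drawing of `G` in the plane without self-intersections. The vertices are distinct points;
each edge `e` is a polygonal line with `len e ≥ 1` segments, parametrized by `[0, len e]`, that
joins the points of its two ends (a closed polygonal line if `e` is a loop). -/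
structure PlaneDrawing (G : Graph α β) where
  /-- The point that represents a vertex. -/
  point : α → EuclideanSpace ℝ (Fin 2)
  /-- The number of segments of the polygonal line that represents an edge. -/
  len : β → ℕ
  /-- The break points of the polygonal line that represents an edge. -/
  node : β → ℕ → EuclideanSpace ℝ (Fin 2)
  point_injOn : Set.InjOn point G.vertexSet
  len_pos : ∀ e ∈ G.edgeSet, 0 < len e
  joins : ∀ e ∈ G.edgeSet, ∃ x y, G.IsLink e x y ∧
    node e 0 = point x ∧ node e (len e) = point y
  /-- No edge crosses or touches itself (a loop only closes up at its vertex). -/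
  edge_injOn : ∀ e ∈ G.edgeSet, Set.InjOn (polyline (node e)) (Set.Ioo 0 (len e : ℝ))
  /-- No edge passes through a vertex in its interior. -/
  edge_ne_point : ∀ e ∈ G.edgeSet, ∀ x ∈ G.vertexSet, ∀ t ∈ Set.Ioo 0 (len e : ℝ),
    polyline (node e) t ≠ point x
  /-- The interiors of two different edges are disjoint. -/
  edge_ne_edge : ∀ e ∈ G.edgeSet, ∀ f ∈ G.edgeSet, e ≠ f →
    ∀ s ∈ Set.Ioo 0 (len e : ℝ), ∀ t ∈ Set.Ioo 0 (len f : ℝ),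
      polyline (node e) s ≠ polyline (node f) t

/-- A graph is planar if it can be drawn in the plane without self-intersections. -/
def IsPlanar (G : Graph α β) : Prop := Nonempty G.PlaneDrawing

/-! ### Euler cycles -/

/-- An Euler cycle of `G`: a closed walk
`vert 0, edge 0, vert 1, edge 1, …, edge (len - 1), vert len = vert 0`
that passes along every edge of `G` exactly once. -/
structure EulerCycle (G : Graph α β) where
  /-- The number of edges. -/
  len : ℕ
  /-- The successive vertices; the values beyond `len` are irrelevant. -/
  vert : ℕ → α
  /-- The successive edges; the values from `len` on are irrelevant. -/
  edge : ℕ → β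
  len_pos : 0 < len
  closed : vert len = vert 0
  isLink : ∀ i < len, G.IsLink (edge i) (vert i) (vert (i + 1))
  edge_bijOn : Set.BijOn edge (Set.Iio len) G.edgeSet

/-- The vertices `P` and `Q` occur along the Euler cycle in the cyclic order `PQPQ`. The visits
of the cycle are numbered `0, …, len - 1`, and the cyclic word `PQPQ`, cut at the starting point,
reads either `PQPQ` or `QPQP`. -/
def EulerCycle.Interlaced {G : Graph α β} (T : G.EulerCycle) (P Q : α) : Prop :=
  P ≠ Q ∧ ∃ i j k l : ℕ, i < j ∧ j < k ∧ k < l ∧ l < T.len ∧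
    ((T.vert i = P ∧ T.vert j = Q ∧ T.vert k = P ∧ T.vert l = Q) ∨
      (T.vert i = Q ∧ T.vert j = P ∧ T.vert k = Q ∧ T.vert l = P))

/-- The Euler cycle is convenient: the vertices can be split into two classes (one of which may
be empty) such that no two vertices of the same class are interlaced. -/
def EulerCycle.IsConvenient {G : Graph α β} (T : G.EulerCycle) : Prop :=
  ∃ A B : Set α, A ∪ B = G.vertexSet ∧ Disjoint A B ∧
    (∀ P ∈ A, ∀ Q ∈ A, ¬ T.Interlaced P Q) ∧ (∀ P ∈ B, ∀ Q ∈ B, ¬ T.Interlaced P Q)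

end Graph

end

/-!
# Plane four-valent graphs and convenient Euler cycles

**From a drawing to an Euler cycle.** The only topological input is the vanishing of intersection
numbers in the plane. For an integral cycle `c` of edges of a plane drawing, let `W p` be the sum,
with the coefficients of `c`, of the angles under which its segments are seen from `p`. Off the
cycle, `W` is continuous with values in `2πℤ`, hence it is constant along every edge that does not
belong to `c` (`PolygonalNet.winding_edge`). Near a vertex its dependence on the direction of
approach is explicit: at a half-edge of `c` it jumps by `2π` times the coefficient
(`PolygonalNet.winding_eq_sub_sum`). Summing the jumps along a second cycle `c'` without common
edges gives `PolygonalNet.intersection_eq_zero`, a relation that involves only the cyclic order of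
the half-edges around the vertices. The rest is combinatorics of four-valent maps, that is, of
fixed-point-free involutions of `V × Fin 4`.

At each vertex there are two ways to pair the four half-edges without crossing. The circuits of such
a pairing do not cross themselves or each other, and changing the pairing at a vertex where two
circuits touch merges them; hence by connectedness some pairing has a single circuit
(`exists_tour`). This is the Euler cycle. Around a vertex that it visits twice, arriving and leaving
half-edges alternate (`Tour.side_eq_or_eq`), so there are two kinds of vertices, those where the
cycle touches itself on its left and those where it does so on its right. If `P` and `Q` are
interlaced, the Euler cycle consists of four arcs `a, c` from `P` to `Q` and `b, d` from `Q` to `P`;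
the closed curves formed by `a, c` and by `b, d` cross at `P` and `Q` only, and the two crossings
would have the same sign if `P` and `Q` were of the same kind (`Tour.side_add_side`).

**From an Euler cycle to a drawing.** Cut the Euler cycle open and lay it out along a horizontal
axis. A vertex with visits `i < k` becomes a chord from `i` to `k`; the chords of one class are
drawn above the axis, those of the other below, and chords of one class are disjoint or nested. A
chord is contracted to the apex of an isosceles right triangle above (or below) it, from which four
segments lead to the axis just before and just after its two ends. Triangles of disjoint chords are
disjoint, and the triangle of a nested chord fits between the left and the right pair of segments,
so these segments do not meet (`ChordDiagram.leg_inj`). Short segments on the axis, and a detour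
above everything from the last visit to the first, complete the edges.
-/

namespace FourValentMap

open Finset

variable {V : Type*}

/-! ### Half-edges at four-valent vertices -/

/-- The sign of `a - b`. -/
def rankSign (a b : Fin 4) : ℤ := if a < b then -1 else if b < a then 1 else 0

/-- For four different half-edges around a vertex, this is `2` or `-2` if the pairs `{a, b}` and
`{c, d}` separate each other in the cyclic order, and `0` otherwise. -/
def crossing (a b c d : Fin 4) : ℤ :=
  rankSign a c - rankSign a d - rankSign b c + rankSign b d

/-- The two ways to pair the four half-edges `0, 1, 2, 3` around a vertex without crossing. -/
def mate : Bool → Fin 4 → Fin 4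
  | false => ![1, 0, 3, 2]
  | true => ![3, 2, 1, 0]

/-- The half-edge that is paired with `h`, where `χ` prescribes the pairing at every vertex. -/
def pairing (χ : V → Bool) (h : V × Fin 4) : V × Fin 4 := (h.1, mate (χ h.1) h.2)

lemma mate_mate : ∀ (b : Bool) (r : Fin 4), mate b (mate b r) = r := by decide

lemma mate_ne : ∀ (b : Bool) (r : Fin 4), mate b r ≠ r := by decide

lemma mate_eq_not_or : ∀ (b : Bool) (r s : Fin 4), s = r ∨ s = mate b r ∨ s = mate (!b) r ∨
    s = mate b (mate (!b) r) := by decide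

lemma crossing_mate : ∀ (b : Bool) (r s : Fin 4), s ≠ r → s ≠ mate b r →
    crossing r (mate b r) s (mate b s) = 0 := by decide

lemma eq_of_three_pairs : ∀ (b : Bool) (r s q : Fin 4), s ≠ r → s ≠ mate b r →
    q = r ∨ q = mate b r ∨ q = s ∨ q = mate b s := by decide

lemma crossing_out_in : ∀ (b : Bool) (r s : Fin 4), s ≠ r → s ≠ mate b r →
    crossing r (mate b s) s (mate b r) = 0 →
    crossing r s (mate b r) (mate b s) = 2 ∨ crossing r s (mate b r) (mate b s) = -2 := by
  decide

@[simp] lemma pairing_fst (χ : V → Bool) (h : V × Fin 4) : (pairing χ h).1 = h.1 := rfl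

lemma pairing_pairing (χ : V → Bool) (h : V × Fin 4) : pairing χ (pairing χ h) = h := by
  simp [pairing, mate_mate]

lemma pairing_ne (χ : V → Bool) (h : V × Fin 4) : pairing χ h ≠ h := fun e =>
  mate_ne (χ h.1) h.2 (congrArg Prod.snd e)

/-- A finite set with a fixed-point-free involution has an even number of elements. -/
lemma even_card_of_involution {H : Type*} (S : Finset H) (f : H → H)
    (hf : ∀ h, f (f h) = h) (hne : ∀ h, f h ≠ h) (hS : ∀ h ∈ S, f h ∈ S) : Even S.card := by
  classical
  have := Finset.sum_involution (s := S) (f := fun _ => (1 : ZMod 2)) (fun h _ => f h)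
    (fun _ _ => by decide) (fun h _ _ => hne h) (fun h hh => hS h hh) (fun h _ => hf h)
  rw [Finset.sum_const, nsmul_eq_mul, mul_one] at this
  exact (ZMod.natCast_eq_zero_iff_even).1 this

/-! ### A planar pairing with a single circuit -/

/-- The half-edges on the circuit through `h₀` that alternates between the two involutions `ε`
(along an edge) and `pairing χ` (across a vertex). -/
def circuit (ε : V × Fin 4 → V × Fin 4) (χ : V → Bool) (h₀ : V × Fin 4) : Set (V × Fin 4) :=
  {h | Relation.ReflTransGen (fun a b => b = ε a ∨ b = pairing χ a) h₀ h}

section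
variable {ε : V × Fin 4 → V × Fin 4} {χ : V → Bool} {h₀ h : V × Fin 4}

lemma mem_circuit_self : h₀ ∈ circuit ε χ h₀ := Relation.ReflTransGen.refl

lemma edge_mem_circuit (hh : h ∈ circuit ε χ h₀) : ε h ∈ circuit ε χ h₀ :=
  Relation.ReflTransGen.tail hh (Or.inl rfl)

lemma pairing_mem_circuit (hh : h ∈ circuit ε χ h₀) : pairing χ h ∈ circuit ε χ h₀ :=
  Relation.ReflTransGen.tail hh (Or.inr rfl)

lemma circuit_subset {S : Set (V × Fin 4)} (h0 : h₀ ∈ S) (h1 : ∀ h ∈ S, ε h ∈ S)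
    (h2 : ∀ h ∈ S, pairing χ h ∈ S) : circuit ε χ h₀ ⊆ S := by
  intro h hh
  induction hh with
  | refl => exact h0
  | tail _ hb ih =>
    rcases hb with rfl | rfl
    · exact h1 _ ih
    · exact h2 _ ih

/-- If the circuit through `h₀` uses only one of the two pairs at the vertex `x`, then changing
the pairing at `x` makes it strictly longer. The part `S` of the old circuit that survives is
closed under `ε`, and under the old pairing except perhaps at the pair at `x`; by parity it
contains both or none of that pair. -/
lemma circuit_ssubset [Fintype V] [DecidableEq V] (hε : ∀ h, ε (ε h) = h) (hε' : ∀ h, ε h ≠ h)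
    {x : V} {r : Fin 4} (hr : (x, r) ∈ circuit ε χ h₀)
    (hr' : (x, mate (!χ x) r) ∉ circuit ε χ h₀) :
    circuit ε χ h₀ ⊂ circuit ε (Function.update χ x (!χ x)) h₀ := by
  classical
  set χ' := Function.update χ x (!χ x) with hχ'
  set C := circuit ε χ h₀
  set C' := circuit ε χ' h₀
  have hoff : ∀ h : V × Fin 4, h.1 ≠ x → pairing χ' h = pairing χ h := by
    intro h hx
    simp [pairing, hχ', Function.update_of_ne hx]
  have hmr : (x, mate (χ x) r) ∈ C := pairing_mem_circuit hr
  have hnot : (x, mate (χ x) (mate (!χ x) r)) ∉ C := by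
    intro hh
    have := pairing_mem_circuit hh
    simp only [pairing, mate_mate] at this
    exact hr' this
  have hfib : ∀ h ∈ C, h.1 = x → h = (x, r) ∨ h = (x, mate (χ x) r) := by
    rintro ⟨y, s⟩ hh (rfl : y = x)
    rcases mate_eq_not_or (χ y) r s with rfl | rfl | rfl | rfl
    · exact Or.inl rfl
    · exact Or.inr rfl
    · exact absurd hh hr'
    · exact absurd hh hnot
  have hCε : ∀ h ∈ C ∩ C', ε h ∈ C ∩ C' := fun h hh =>
    ⟨edge_mem_circuit hh.1, edge_mem_circuit hh.2⟩
  have hCμ : ∀ h ∈ C ∩ C', h.1 ≠ x → pairing χ h ∈ C ∩ C' := fun h hh hx =>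
    ⟨pairing_mem_circuit hh.1, hoff h hx ▸ pairing_mem_circuit hh.2⟩
  have heven : Even (C ∩ C').toFinset.card :=
    even_card_of_involution _ ε hε hε' (by simpa using fun a b => hCε (a, b))
  have key : ∀ q : Fin 4, (x, q) ∈ C → (x, q) ∈ C' → (x, mate (χ x) q) ∈ C' := by
    intro q hq hq'
    by_contra hn
    have hod : Even ((C ∩ C').toFinset.erase (x, q)).card := by
      refine even_card_of_involution _ (pairing χ) (pairing_pairing χ) (pairing_ne χ) ?_
      rintro h hh
      rw [Finset.mem_erase, Set.mem_toFinset] at hh ⊢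
      have hx : h.1 ≠ x := by
        intro hx
        have hqq := hfib _ hq rfl
        have hmm := hfib _ hh.2.1 hx
        have : h = (x, mate (χ x) q) := by
          rcases hqq with e | e <;> rcases hmm with e' | e' <;> rw [Prod.mk.injEq] at e
          · exact absurd (by rw [e', e.2]) hh.1
          · rw [e', e.2]
          · rw [e', e.2, mate_mate]
          · exact absurd (by rw [e', e.2]) hh.1
        exact hn (this ▸ hh.2.2)
      refine ⟨fun e => hx ?_, hCμ h hh.2 hx⟩
      exact congrArg Prod.fst e
    have hmem : (x, q) ∈ (C ∩ C').toFinset := by simpa using ⟨hq, hq'⟩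
    have hcard := Finset.card_erase_add_one hmem
    rw [← hcard] at heven
    exact (Nat.not_even_iff_odd.2 hod.add_one) heven
  have hsub : C ⊆ C' := by
    have : C ⊆ C ∩ C' := by
      refine circuit_subset ⟨mem_circuit_self, mem_circuit_self⟩ hCε ?_
      intro h hh
      by_cases hx : h.1 = x
      · obtain ⟨y, q⟩ := h
        obtain rfl : y = x := hx
        exact ⟨pairing_mem_circuit hh.1, key q hh.1 hh.2⟩
      · exact hCμ h hh hx
    exact fun h hh => (this hh).2
  refine ⟨hsub, fun hsup => hr' (hsup ?_)⟩
  have := pairing_mem_circuit (hsub hr : (x, r) ∈ C')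
  simpa [pairing, hχ'] using this

/-- A connected four-valent map has a non-crossing pairing with a single circuit: choose one that
makes the circuit through a given half-edge as long as possible. -/
lemma exists_pairing_circuit_eq_univ [Fintype V] [DecidableEq V]
    (hε : ∀ h, ε (ε h) = h) (hε' : ∀ h, ε h ≠ h)
    (hconn : ∀ S : Set (V × Fin 4), S.Nonempty → (∀ h ∈ S, ε h ∈ S) →
      (∀ x r s, (x, r) ∈ S → (x, s) ∈ S) → S = Set.univ) (h₀ : V × Fin 4) :
    ∃ χ : V → Bool, circuit ε χ h₀ = Set.univ := by
  classical
  obtain ⟨χ, -, hχ⟩ := Finset.exists_max_image (Finset.univ : Finset (V → Bool))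
    (fun χ => (circuit ε χ h₀).toFinset.card) ⟨fun _ => false, Finset.mem_univ _⟩
  refine ⟨χ, hconn _ ⟨h₀, mem_circuit_self⟩ (fun h hh => edge_mem_circuit hh) ?_⟩
  intro x r s hr
  by_contra hs
  have hr' : (x, mate (!χ x) r) ∉ circuit ε χ h₀ := by
    intro hh
    rcases mate_eq_not_or (χ x) r s with rfl | rfl | rfl | rfl
    · exact hs hr
    · exact hs (pairing_mem_circuit hr)
    · exact hs hh
    · exact hs (pairing_mem_circuit hh)
  have hlt := Finset.card_lt_card (Set.toFinset_ssubset_toFinset.2 (circuit_ssubset hε hε' hr hr'))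
  exact absurd (hχ _ (Finset.mem_univ _)) (not_le.2 hlt)

end

/-! ### The Euler cycle of a pairing with a single circuit -/

/-- A circuit that runs through all edges of the four-valent map `ε`, without crossing itself at
the vertices: `out t` is the half-edge along which it leaves at its `t`-th visit of a vertex,
`pairing χ (out t)` the one along which it arrives. -/
structure Tour (ε : V × Fin 4 → V × Fin 4) where
  /-- The number of edges. -/
  len : ℕ
  /-- The pairing at the vertices. -/
  χ : V → Bool
  /-- The half-edges along which the circuit leaves the vertices. -/
  out : ℕ → V × Fin 4
  len_pos : 0 < len
  closed : out len = out 0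
  edge_out : ∀ t, ε (out t) = pairing χ (out (t + 1))
  exists_eq : ∀ h, ∃ t < len, h = out t ∨ h = ε (out t)
  unique : ∀ t < len, ∀ s < len, out t = out s ∨ out t = ε (out s) → t = s

/-- The composition of two involutions without fixed points never maps `h` to its image under the
second one. -/
lemma iterate_comp_ne {H : Type*} {f g : H → H} (hf : ∀ h, f (f h) = h) (hf' : ∀ h, f h ≠ h)
    (hg : ∀ h, g (g h) = h) (hg' : ∀ h, g h ≠ h) (n : ℕ) (h : H) :
    (fun x => f (g x))^[n] h ≠ g h := by
  induction n using Nat.strong_induction_on generalizing h with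
  | _ n ih =>
    rcases n with _ | _ | n
    · exact fun e => hg' h e.symm
    · exact hf' _
    · intro e
      refine ih n (by omega) (f (g h)) ?_
      rw [Function.iterate_succ_apply', Function.iterate_succ_apply] at e
      have := congrArg f e
      rw [hf] at this
      have := congrArg g this
      rwa [hg] at this

lemma exists_tour [Fintype V] [DecidableEq V] {ε : V × Fin 4 → V × Fin 4}
    (hε : ∀ h, ε (ε h) = h) (hε' : ∀ h, ε h ≠ h)
    (hconn : ∀ S : Set (V × Fin 4), S.Nonempty → (∀ h ∈ S, ε h ∈ S) →
      (∀ x r s, (x, r) ∈ S → (x, s) ∈ S) → S = Set.univ) [Nonempty V] : Nonempty (Tour ε) := by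
  obtain ⟨x⟩ := ‹Nonempty V›
  obtain ⟨χ, hχ⟩ := exists_pairing_circuit_eq_univ hε hε' hconn (x, 0)
  set ρ : V × Fin 4 → V × Fin 4 := fun h => pairing χ (ε h) with hρ
  have hinj : Function.Injective ρ := by
    intro a b hab
    have := congrArg (pairing χ) hab
    simp only [hρ, pairing_pairing] at this
    rw [← hε a, this, hε]
  have hper : (x, (0 : Fin 4)) ∈ Function.periodicPts ρ := by
    exact hinj.mem_periodicPts _
  have hpos := Function.minimalPeriod_pos_of_mem_periodicPts hper
  have hstep : ∀ t, ε (ρ^[t] (x, 0)) = pairing χ (ρ^[t + 1] (x, 0)) := by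
    intro t
    rw [Function.iterate_succ_apply']
    simp only [hρ, pairing_pairing]
  refine ⟨⟨Function.minimalPeriod ρ (x, 0), χ, fun t => ρ^[t] (x, 0), hpos, ?_, hstep, ?_, ?_⟩⟩
  · exact Function.iterate_minimalPeriod
  · intro h
    have hmem : h ∈ circuit ε χ (x, 0) := hχ ▸ Set.mem_univ h
    have hall : ∀ t, ∃ s < Function.minimalPeriod ρ (x, 0), ρ^[t] (x, 0) = ρ^[s] (x, 0) :=
      fun t => ⟨t % _, Nat.mod_lt _ hpos, (Function.iterate_mod_minimalPeriod_eq).symm⟩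
    have hall' : ∀ t, ∃ s, ρ^[t] (x, 0) = ρ^[s + 1] (x, 0) := by
      intro t
      refine ⟨t + Function.minimalPeriod ρ (x, 0) - 1, ?_⟩
      rw [Nat.sub_add_cancel (by omega), Function.iterate_add_apply,
        Function.iterate_minimalPeriod]
    refine circuit_subset (S := {h | ∃ t < Function.minimalPeriod ρ (x, 0),
      h = ρ^[t] (x, 0) ∨ h = ε (ρ^[t] (x, 0))}) ⟨0, hpos, Or.inl rfl⟩ ?_ ?_ hmem
    · rintro _ ⟨t, ht, rfl | rfl⟩
      · exact ⟨t, ht, Or.inr rfl⟩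
      · exact ⟨t, ht, Or.inl (hε _)⟩
    · rintro _ ⟨t, ht, rfl | rfl⟩
      · obtain ⟨s, hs⟩ := hall' t
        obtain ⟨s', hs', e⟩ := hall s
        refine ⟨s', hs', Or.inr ?_⟩
        rw [hs, ← hstep, e]
      · obtain ⟨s, hs, e⟩ := hall (t + 1)
        refine ⟨s, hs, Or.inl ?_⟩
        rw [← e, hstep, pairing_pairing]
  · have aux : ∀ s d, ρ^[s + d] (x, 0) ≠ ε (ρ^[s] (x, 0)) := by
      intro s d
      rw [add_comm, Function.iterate_add_apply]
      exact iterate_comp_ne (pairing_pairing χ) (pairing_ne χ) hε hε' d _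
    rintro t ht s hs (e | e)
    · exact Function.iterate_injOn_Iio_minimalPeriod ht hs e
    · rcases le_total s t with hst | hst
      · obtain ⟨d, rfl⟩ := Nat.exists_eq_add_of_le hst
        exact absurd e (aux s d)
      · obtain ⟨d, rfl⟩ := Nat.exists_eq_add_of_le hst
        exact absurd (by rw [e, hε]) (aux t d)

/-! ### Planarity and intersection numbers of cycles -/

/-- An integral cycle: a function on the half-edges whose values at the two ends of every edge are
opposite, and whose values around every vertex add up to zero. -/
def IsCycle (ε : V × Fin 4 → V × Fin 4) (c : V × Fin 4 → ℤ) : Prop :=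
  (∀ h, c (ε h) = -c h) ∧ ∀ x, ∑ r, c (x, r) = 0

/-- Planarity of the map `ε`, in the form in which it is used: the intersection number of two
cycles without common edges vanishes. -/
def IsPlanarMap [Fintype V] (ε : V × Fin 4 → V × Fin 4) : Prop :=
  ∀ c c' : V × Fin 4 → ℤ, IsCycle ε c → IsCycle ε c' → (∀ h, c h = 0 ∨ c' h = 0) →
    ∑ x, ∑ r, ∑ s, c (x, r) * c' (x, s) * rankSign r s = 0

namespace Tour

variable {ε : V × Fin 4 → V × Fin 4} (T : Tour ε)

/-- The vertex of the `t`-th visit. -/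
def vert (t : ℕ) : V := (T.out t).1

/-- The rank at its vertex of the half-edge along which the circuit leaves. -/
def rank (t : ℕ) : Fin 4 := (T.out t).2

/-- The rank at its vertex of the half-edge along which the circuit arrives. -/
def rankIn (t : ℕ) : Fin 4 := mate (T.χ (T.vert t)) (T.rank t)

lemma exists_edge_eq_pairing {s : ℕ} (hs : s < T.len) :
    ∃ p < T.len, pairing T.χ (T.out s) = ε (T.out p) := by
  rcases s with _ | s
  · have := T.len_pos
    refine ⟨T.len - 1, by omega, ?_⟩
    rw [T.edge_out, Nat.sub_add_cancel this, T.closed]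
  · exact ⟨s, by omega, (T.edge_out s).symm⟩

section
variable (hε' : ∀ h, ε h ≠ h)
include hε'

lemma visit_unique {t s : ℕ} (ht : t < T.len) (hs : s < T.len) (hne : t ≠ s)
    (hv : T.vert t = T.vert s) : T.rank t ≠ T.rank s ∧ T.rank t ≠ T.rankIn s := by
  refine ⟨fun e => hne (T.unique t ht s hs (Or.inl (Prod.ext hv e))), fun e => ?_⟩
  have e' : T.out t = pairing T.χ (T.out s) := Prod.ext hv e
  obtain ⟨p, hp, hpe⟩ := T.exists_edge_eq_pairing hs
  rw [hpe] at e'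
  obtain rfl := T.unique t ht p hp (Or.inr e')
  exact hε' _ e'.symm

/-- A vertex is visited at most twice. -/
lemma eq_or_eq_of_vert_eq {i k t : ℕ} (hi : i < T.len) (hk : k < T.len) (ht : t < T.len)
    (hik : i ≠ k) (hv : T.vert k = T.vert i) (hvt : T.vert t = T.vert i) : t = i ∨ t = k := by
  by_contra! hne
  have h1 := T.visit_unique hε' hk hi (Ne.symm hik) hv
  have h2 := T.visit_unique hε' ht hi hne.1 hvt
  have h3 := T.visit_unique hε' ht hk hne.2 (hvt.trans hv.symm)
  have := eq_of_three_pairs (T.χ (T.vert i)) (T.rank i) (T.rank k) (T.rank t) h1.1 h1.2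
  simp only [rankIn, hv] at h2 h3
  rcases this with e | e | e | e
  exacts [h2.1 e, h2.2 e, h3.1 e, h3.2 e]

end

/-- The chain in which the edge that the tour passes between its visits `t` and `t + 1` has the
coefficient `u (t + 1)`. -/
def chain [DecidableEq V] (u : ℕ → ℤ) (h : V × Fin 4) : ℤ :=
  ∑ t ∈ range T.len, u (t + 1) *
    ((if h = T.out t then 1 else 0) - if h = ε (T.out t) then 1 else 0)

lemma sum_chain_mul [Fintype V] [DecidableEq V] {u : ℕ → ℤ} (hu : u T.len = u 0)
    (φ : V × Fin 4 → ℤ) : ∑ h, T.chain u h * φ h =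
      ∑ t ∈ range T.len, (u (t + 1) * φ (T.out t) - u t * φ (pairing T.χ (T.out t))) := by
  have h1 : ∑ h, T.chain u h * φ h = ∑ t ∈ range T.len, u (t + 1) * φ (T.out t) -
      ∑ t ∈ range T.len, u (t + 1) * φ (pairing T.χ (T.out (t + 1))) := by
    simp only [chain, Finset.sum_mul]
    rw [Finset.sum_comm, ← Finset.sum_sub_distrib]
    refine Finset.sum_congr rfl fun t _ => ?_
    rw [← T.edge_out]
    simp [sub_mul, Finset.sum_sub_distrib, mul_sub]
  have h2 := (Finset.sum_range_succ (fun t => u t * φ (pairing T.χ (T.out t))) T.len).symm.trans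
    (Finset.sum_range_succ' (fun t => u t * φ (pairing T.χ (T.out t))) T.len)
  rw [T.closed, hu] at h2
  rw [h1, Finset.sum_sub_distrib]
  linarith

lemma chain_edge [DecidableEq V] (hε : ∀ h, ε (ε h) = h) (u : ℕ → ℤ) (h : V × Fin 4) :
    T.chain u (ε h) = -T.chain u h := by
  have aux : ∀ a, (ε h = ε a ↔ h = a) ∧ (ε h = a ↔ h = ε a) := fun a =>
    ⟨⟨fun e => by rw [← hε h, e, hε], fun e => by rw [e]⟩,
      ⟨fun e => by rw [← e, hε], fun e => by rw [e, hε]⟩⟩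
  simp only [chain, ← Finset.sum_neg_distrib, (aux _).1, (aux _).2]
  exact Finset.sum_congr rfl fun t _ => by ring

lemma chain_eq_zero [DecidableEq V] (hε : ∀ h, ε (ε h) = h) {u : ℕ → ℤ} {t : ℕ} (ht : t < T.len)
    (hu : u (t + 1) = 0) {h : V × Fin 4} (hh : h = T.out t ∨ h = ε (T.out t)) :
    T.chain u h = 0 := by
  have key : T.chain u (T.out t) = 0 := by
    refine Finset.sum_eq_zero fun s hs => ?_
    by_cases hst : t = s
    · subst hst; rw [hu, zero_mul]
    · have := mt (T.unique t ht s (Finset.mem_range.1 hs)) hst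
      push Not at this
      rw [if_neg this.1, if_neg this.2, sub_zero, mul_zero]
  rcases hh with rfl | rfl
  · exact key
  · rw [chain_edge T hε, key, neg_zero]

lemma isCycle_chain [Fintype V] [DecidableEq V] (hε : ∀ h, ε (ε h) = h) {u : ℕ → ℤ}
    (hu : u T.len = u 0)
    (hb : ∀ x, ∑ t ∈ range T.len, (if T.vert t = x then u (t + 1) - u t else 0) = 0) :
    IsCycle ε (T.chain u) := by
  refine ⟨T.chain_edge hε u, fun x => ?_⟩
  refine Eq.trans ?_ (hb x)
  have := T.sum_chain_mul hu (fun h => if h.1 = x then 1 else 0)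
  rw [Fintype.sum_prod_type] at this
  simp only [mul_ite, mul_one, mul_zero, Finset.sum_ite_irrel, Finset.sum_const_zero,
    Finset.sum_ite_eq', Finset.mem_univ, if_true] at this
  rw [this]
  refine Finset.sum_congr rfl fun t _ => ?_
  by_cases hx : (T.out t).1 = x <;> simp [vert, hx]

/-- The contribution of the visits `t` and `s` of a vertex to the intersection number of the chains
`u` and `w`. -/
def localTerm (u w : ℕ → ℤ) (t s : ℕ) : ℤ :=
  u (t + 1) * w (s + 1) * rankSign (T.rank t) (T.rank s) -
    u (t + 1) * w s * rankSign (T.rank t) (T.rankIn s) -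
    u t * w (s + 1) * rankSign (T.rankIn t) (T.rank s) +
    u t * w s * rankSign (T.rankIn t) (T.rankIn s)

lemma sum_localTerm_eq_zero [Fintype V] [DecidableEq V] (hε : ∀ h, ε (ε h) = h)
    (hK : IsPlanarMap ε) {u w : ℕ → ℤ}
    (hu : u T.len = u 0) (hw : w T.len = w 0) (huw : ∀ t, u t = 0 ∨ w t = 0)
    (hbu : ∀ x, ∑ t ∈ range T.len, (if T.vert t = x then u (t + 1) - u t else 0) = 0)
    (hbw : ∀ x, ∑ t ∈ range T.len, (if T.vert t = x then w (t + 1) - w t else 0) = 0) :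
    ∑ t ∈ range T.len, ∑ s ∈ range T.len,
      (if T.vert t = T.vert s then T.localTerm u w t s else 0) = 0 := by
  have h0 := hK _ _ (T.isCycle_chain hε hu hbu) (T.isCycle_chain hε hw hbw) (by
    intro h
    obtain ⟨t, ht, hh⟩ := T.exists_eq h
    exact (huw (t + 1)).imp (fun e => T.chain_eq_zero hε ht e hh)
      (fun e => T.chain_eq_zero hε ht e hh))
  have h1 : ∑ h, T.chain u h * ∑ h', T.chain w h' *
      (if h.1 = h'.1 then rankSign h.2 h'.2 else 0) = 0 := by
    refine Eq.trans ?_ h0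
    rw [Fintype.sum_prod_type]
    refine Finset.sum_congr rfl fun x _ => Finset.sum_congr rfl fun r _ => ?_
    rw [Fintype.sum_prod_type, Finset.mul_sum, Finset.sum_eq_single x]
    · simp [Finset.mul_sum, mul_assoc]
    · intro y _ hy
      simp [hy.symm]
    · simp
  rw [T.sum_chain_mul hu] at h1
  refine Eq.trans ?_ h1
  refine Finset.sum_congr rfl fun t _ => ?_
  rw [T.sum_chain_mul hw, T.sum_chain_mul hw, Finset.mul_sum, Finset.mul_sum,
    ← Finset.sum_sub_distrib]
  refine Finset.sum_congr rfl fun s _ => ?_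
  simp only [pairing_fst, vert, localTerm, rank, rankIn]
  by_cases e : (T.out t).1 = (T.out s).1
  · simp only [e, if_true, pairing]; ring
  · simp [e]

/-- Where neither chain turns, the planar pairing lets them touch without crossing. -/
lemma localTerm_eq_zero (hε' : ∀ h, ε h ≠ h) {u w : ℕ → ℤ} (huw : ∀ t, u t = 0 ∨ w t = 0)
    {t s : ℕ} (ht : t < T.len) (hs : s < T.len) (hv : T.vert t = T.vert s)
    (hut : u (t + 1) = u t) (hws : w (s + 1) = w s) : T.localTerm u w t s = 0 := by
  by_cases hts : t = s
  · subst hts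
    rcases huw t with h | h <;> simp [localTerm, hut, hws, h]
  · have h1 := T.visit_unique hε' hs ht (Ne.symm hts) hv.symm
    have h2 := crossing_mate (T.χ (T.vert t)) (T.rank t) (T.rank s) h1.1 h1.2
    have h3 : T.localTerm u w t s = u t * w s * crossing (T.rank t) (mate (T.χ (T.vert t))
        (T.rank t)) (T.rank s) (mate (T.χ (T.vert t)) (T.rank s)) := by
      simp only [localTerm, hut, hws, crossing, rankIn, ← hv]; ring
    rw [h3, h2, mul_zero]

/-- The intersection number of two chains of the tour only depends on the visits in `S` where they
turn. -/
lemma sum_localTerm_turns [Fintype V] [DecidableEq V] (hε : ∀ h, ε (ε h) = h)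
    (hε' : ∀ h, ε h ≠ h) (hK : IsPlanarMap ε) {u w : ℕ → ℤ} (S : Finset ℕ)
    (hS : ∀ t ∈ S, t < T.len) (hclosed : ∀ t < T.len, ∀ s ∈ S, T.vert t = T.vert s → t ∈ S)
    (hturn : ∀ t, t ∉ S → u (t + 1) = u t ∧ w (t + 1) = w t)
    (hu : u T.len = u 0) (hw : w T.len = w 0) (huw : ∀ t, u t = 0 ∨ w t = 0)
    (hbu : ∀ x, ∑ t ∈ S, (if T.vert t = x then u (t + 1) - u t else 0) = 0)
    (hbw : ∀ x, ∑ t ∈ S, (if T.vert t = x then w (t + 1) - w t else 0) = 0) :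
    ∑ t ∈ S, ∑ s ∈ S, (if T.vert t = T.vert s then T.localTerm u w t s else 0) = 0 := by
  have hsub : S ⊆ range T.len := fun t ht => Finset.mem_range.2 (hS t ht)
  have h := T.sum_localTerm_eq_zero hε hK hu hw huw
    (fun x => by
      rw [← Finset.sum_subset hsub, hbu x]
      intro t _ htS
      simp [(hturn t htS).1])
    (fun x => by
      rw [← Finset.sum_subset hsub, hbw x]
      intro t _ htS
      simp [(hturn t htS).2])
  rw [← Finset.sum_subset hsub] at h
  · refine Eq.trans (Finset.sum_congr rfl fun t ht => ?_) h
    refine Finset.sum_subset hsub fun s hs hsS => if_neg fun e => ?_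
    exact hsS (hclosed s (Finset.mem_range.1 hs) t ht e.symm)
  · intro t ht htS
    refine Finset.sum_eq_zero fun s hs => ?_
    split_ifs with e
    · refine T.localTerm_eq_zero hε' huw (Finset.mem_range.1 ht) (Finset.mem_range.1 hs) e
        (hturn t htS).1 (hturn s fun hsS => htS ?_).2
      exact hclosed t (Finset.mem_range.1 ht) s hsS e
    · rfl

/-- The side of the tour on which it touches itself at the vertex of its visits `t` and `s`:
`2` on the one, `-2` on the other. -/
def side (t s : ℕ) : ℤ := crossing (T.rank t) (T.rank s) (T.rankIn t) (T.rankIn s)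

variable [Fintype V] [DecidableEq V] (hε : ∀ h, ε (ε h) = h) (hε' : ∀ h, ε h ≠ h)
  (hK : IsPlanarMap ε)
include hε hε' hK

/-- Around a vertex that is visited twice, arriving and leaving half-edges alternate: otherwise
the two loops into which the vertex splits the tour would cross each other only there. -/
lemma side_eq_or_eq {i k : ℕ} (hik : i < k) (hk : k < T.len) (hv : T.vert i = T.vert k) :
    T.side i k = 2 ∨ T.side i k = -2 := by
  obtain ⟨u, hu⟩ : ∃ u : ℕ → ℤ, ∀ t, u t = if i < t ∧ t ≤ k then 1 else 0 := ⟨_, fun _ => rfl⟩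
  obtain ⟨w, hw⟩ : ∃ w : ℕ → ℤ, ∀ t, w t = if i < t ∧ t ≤ k then 0 else 1 := ⟨_, fun _ => rfl⟩
  have u1 : u i = 0 := by rw [hu, if_neg (by omega)]
  have u2 : u (i + 1) = 1 := by rw [hu, if_pos (by omega)]
  have u3 : u k = 1 := by rw [hu, if_pos (by omega)]
  have u4 : u (k + 1) = 0 := by rw [hu, if_neg (by omega)]
  have w1 : w i = 1 := by rw [hw, if_neg (by omega)]
  have w2 : w (i + 1) = 0 := by rw [hw, if_pos (by omega)]
  have w3 : w k = 0 := by rw [hw, if_pos (by omega)]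
  have w4 : w (k + 1) = 1 := by rw [hw, if_neg (by omega)]
  have hne : i ≠ k := hik.ne
  have h := T.sum_localTerm_turns hε hε' hK (u := u) (w := w) {i, k} (by simp; omega)
    (by
      intro t ht s hs e
      rw [Finset.mem_insert, Finset.mem_singleton] at hs ⊢
      refine T.eq_or_eq_of_vert_eq hε' (hik.trans hk) hk ht hne hv.symm ?_
      rcases hs with rfl | rfl
      · exact e
      · exact e.trans hv.symm)
    (by
      intro t ht
      simp only [Finset.mem_insert, Finset.mem_singleton, not_or] at ht
      rw [hu, hu, hw, hw]
      split_ifs <;> omega)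
    (by rw [hu, hu, if_neg (by omega), if_neg (by omega)])
    (by rw [hw, hw, if_neg (by omega), if_neg (by omega)])
    (by intro t; rw [hu, hw]; split_ifs <;> simp)
    (by
      intro x
      rw [Finset.sum_pair hne, u1, u2, u3, u4, hv]
      split_ifs <;> simp)
    (by
      intro x
      rw [Finset.sum_pair hne, w1, w2, w3, w4, hv]
      split_ifs <;> simp)
  rw [Finset.sum_pair hne, Finset.sum_pair hne, Finset.sum_pair hne] at h
  simp only [hv, if_true, localTerm, u1, u2, u3, u4, w1, w2, w3, w4] at h
  have h1 := T.visit_unique hε' hk (hik.trans hk) hne.symm hv.symm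
  simp only [rankIn, ← hv] at h h1
  have := crossing_out_in (T.χ (T.vert i)) (T.rank i) (T.rank k) h1.1 h1.2
    (by simp only [crossing]; linarith)
  simpa only [side, rankIn, ← hv] using this

/-- Two interlaced vertices lie on different sides of the tour. -/
lemma side_add_side {i j k l : ℕ} (hij : i < j) (hjk : j < k) (hkl : k < l) (hl : l < T.len)
    (hik : T.vert i = T.vert k) (hjl : T.vert j = T.vert l) (hne : T.vert i ≠ T.vert j) :
    T.side i k + T.side j l = 0 := by
  obtain ⟨u, hu⟩ : ∃ u : ℕ → ℤ, ∀ t, u t = if i < t ∧ t ≤ j then 1 else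
    if k < t ∧ t ≤ l then -1 else 0 := ⟨_, fun _ => rfl⟩
  obtain ⟨w, hw⟩ : ∃ w : ℕ → ℤ, ∀ t, w t = if j < t ∧ t ≤ k then 1 else
    if i < t ∧ t ≤ l then 0 else -1 := ⟨_, fun _ => rfl⟩
  have u1 : u i = 0 := by rw [hu, if_neg (by omega), if_neg (by omega)]
  have u2 : u (i + 1) = 1 := by rw [hu, if_pos (by omega)]
  have u3 : u j = 1 := by rw [hu, if_pos (by omega)]
  have u4 : u (j + 1) = 0 := by rw [hu, if_neg (by omega), if_neg (by omega)]
  have u5 : u k = 0 := by rw [hu, if_neg (by omega), if_neg (by omega)]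
  have u6 : u (k + 1) = -1 := by rw [hu, if_neg (by omega), if_pos (by omega)]
  have u7 : u l = -1 := by rw [hu, if_neg (by omega), if_pos (by omega)]
  have u8 : u (l + 1) = 0 := by rw [hu, if_neg (by omega), if_neg (by omega)]
  have w1 : w i = -1 := by rw [hw, if_neg (by omega), if_neg (by omega)]
  have w2 : w (i + 1) = 0 := by rw [hw, if_neg (by omega), if_pos (by omega)]
  have w3 : w j = 0 := by rw [hw, if_neg (by omega), if_pos (by omega)]
  have w4 : w (j + 1) = 1 := by rw [hw, if_pos (by omega)]
  have w5 : w k = 1 := by rw [hw, if_pos (by omega)]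
  have w6 : w (k + 1) = 0 := by rw [hw, if_neg (by omega), if_pos (by omega)]
  have w7 : w l = 0 := by rw [hw, if_neg (by omega), if_pos (by omega)]
  have w8 : w (l + 1) = -1 := by rw [hw, if_neg (by omega), if_neg (by omega)]
  have hsum : ∀ f : ℕ → ℤ, ∑ t ∈ ({i, j, k, l} : Finset ℕ), f t = f i + f j + f k + f l := by
    intro f
    rw [Finset.sum_insert (by simp; omega), Finset.sum_insert (by simp; omega),
      Finset.sum_pair (by omega)]
    ring
  have h := T.sum_localTerm_turns hε hε' hK (u := u) (w := w) {i, j, k, l} (by simp; omega)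
    (by
      intro t ht s hs e
      simp only [Finset.mem_insert, Finset.mem_singleton] at hs ⊢
      have h1 := T.eq_or_eq_of_vert_eq hε' (i := i) (k := k) (by omega) (by omega) ht (by omega)
        hik.symm
      have h2 := T.eq_or_eq_of_vert_eq hε' (i := j) (k := l) (by omega) (by omega) ht (by omega)
        hjl.symm
      rcases hs with rfl | rfl | rfl | rfl
      · have := h1 e; tauto
      · have := h2 e; tauto
      · have := h1 (e.trans hik.symm); tauto
      · have := h2 (e.trans hjl.symm); tauto)
    (by
      intro t ht
      simp only [Finset.mem_insert, Finset.mem_singleton, not_or] at ht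
      rw [hu, hu, hw, hw]
      split_ifs <;> omega)
    (by rw [hu, hu, if_neg (by omega), if_neg (by omega), if_neg (by omega), if_neg (by omega)])
    (by rw [hw, hw, if_neg (by omega), if_neg (by omega), if_neg (by omega), if_neg (by omega)])
    (by intro t; rw [hu, hw]; split_ifs <;> omega)
    (by
      intro x
      rw [hsum, u1, u2, u3, u4, u5, u6, u7, u8, hik, hjl]
      split_ifs <;> simp)
    (by
      intro x
      rw [hsum, w1, w2, w3, w4, w5, w6, w7, w8, hik, hjl]
      split_ifs <;> simp)
  have hne' : T.vert k ≠ T.vert l := by rwa [← hik, ← hjl]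
  simp only [hsum, hik, hjl, if_true, if_neg hne', if_neg hne'.symm, localTerm, u1, u2, u3, u4,
    u5, u6, u7, u8, w1, w2, w3, w4, w5, w6, w7, w8] at h
  have anti : ∀ a b : Fin 4, rankSign a b = -rankSign b a := by decide
  simp only [side, crossing]
  rw [anti (T.rankIn j) (T.rank j), anti (T.rankIn j) (T.rank l), anti (T.rankIn l) (T.rank j),
    anti (T.rankIn l) (T.rank l)] at h
  linarith

/-- The tour of a planar map is convenient. -/
lemma exists_sides : ∃ A : Set V, ∀ i j k l, i < j → j < k → k < l → l < T.len →
    T.vert i = T.vert k → T.vert j = T.vert l → T.vert i ≠ T.vert j →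
    (T.vert i ∈ A ↔ T.vert j ∉ A) := by
  refine ⟨{x | ∃ i k, i < k ∧ k < T.len ∧ T.vert i = x ∧ T.vert k = x ∧ T.side i k = 2}, ?_⟩
  have key : ∀ i k, i < k → k < T.len → T.vert i = T.vert k →
      ((∃ i' k', i' < k' ∧ k' < T.len ∧ T.vert i' = T.vert i ∧ T.vert k' = T.vert i ∧
        T.side i' k' = 2) ↔ T.side i k = 2) := by
    refine fun i k hik hk hv => ⟨?_, fun h => ⟨i, k, hik, hk, rfl, hv.symm, h⟩⟩
    rintro ⟨i', k', hik', hk', hi', hk'', h⟩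
    have h1 := T.eq_or_eq_of_vert_eq hε' (hik.trans hk) hk (hik'.trans hk') hik.ne hv.symm hi'
    have h2 := T.eq_or_eq_of_vert_eq hε' (hik.trans hk) hk hk' hik.ne hv.symm hk''
    obtain ⟨rfl, rfl⟩ : i' = i ∧ k' = k := by omega
    exact h
  intro i j k l hij hjk hkl hl hik hjl hne
  simp only [Set.mem_ofPred_eq]
  rw [key i k (by omega) (by omega) hik, key j l (by omega) hl hjl]
  have h1 := T.side_eq_or_eq hε hε' hK (i := i) (k := k) (by omega) (by omega) hik
  have h2 := T.side_add_side hε hε' hK hij hjk hkl hl hik hjl hne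
  omega

end Tour

/-! ### Angles under which segments are seen -/

section Angles

open Filter Topology Complex

lemma div_mem_slitPlane_of_notMem_segment {a b p : ℂ} (h : p ∉ segment ℝ a b) :
    (b - p) / (a - p) ∈ slitPlane := by
  have ha : a - p ≠ 0 := fun e => h (by rw [← sub_eq_zero.1 e]; exact left_mem_segment ℝ a b)
  by_contra hn
  rw [Complex.mem_slitPlane_iff_not_le_zero, not_not] at hn
  obtain ⟨r, hr, e⟩ : ∃ r : ℝ, 0 ≤ r ∧ (b - p) / (a - p) = -(r : ℂ) := by
    rw [Complex.le_def] at hn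
    refine ⟨-((b - p) / (a - p)).re, by simpa using hn.1, ?_⟩
    apply Complex.ext
    · simp
    · simpa using hn.2
  have hr1 : (1 + r : ℝ) ≠ 0 := by positivity
  have hr1' : (1 + r : ℂ) ≠ 0 := by exact_mod_cast hr1
  refine h ⟨r / (1 + r), 1 / (1 + r), by positivity, by positivity, by field_simp; ring, ?_⟩
  rw [div_eq_iff ha] at e
  simp only [Complex.real_smul]
  push_cast
  field_simp
  linear_combination e

/-- The angle from the direction `d` to the direction opposite to `x`, for two directions given by
different arguments. -/
noncomputable def turn (x d : ℂ) : ℝ :=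
  x.arg - d.arg - Real.pi * (if x.arg < d.arg then -1 else 1 : ℤ)

lemma arg_neg_div {x y : ℂ} (hx : x ≠ 0) (hy : y ≠ 0) (h : x.arg ≠ y.arg) :
    (-(x / y)).arg = turn x y := by
  have h1 : ((-(x / y)).arg : Real.Angle) = (turn x y : ℝ) := by
    rw [arg_neg_coe_angle (div_ne_zero hx hy), arg_div_coe_angle hx hy, turn]
    split_ifs
    · simp [Real.Angle.coe_sub]
    · simp only [Int.cast_one, mul_one, Real.Angle.coe_sub, sub_eq_add_neg _ (Real.pi : Real.Angle),
        Real.Angle.neg_coe_pi]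
  have hx1 := neg_pi_lt_arg x
  have hx2 := arg_le_pi x
  have hy1 := neg_pi_lt_arg y
  have hy2 := arg_le_pi y
  rw [← arg_coe_angle_toReal_eq_arg, h1, Real.Angle.toReal_coe_eq_self_iff, turn]
  split_ifs with hlt
  · push_cast; constructor <;> linarith
  · have := lt_of_le_of_ne (not_lt.1 hlt) (Ne.symm h)
    push_cast; constructor <;> linarith

lemma turn_swap {x y : ℂ} (h : x.arg ≠ y.arg) : turn y x = -turn x y := by
  rcases lt_or_gt_of_ne h with h | h
  · simp only [turn, if_pos h, if_neg h.le.not_gt]; push_cast; ring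
  · simp only [turn, if_pos h, if_neg h.le.not_gt]; push_cast; ring

lemma neg_div_mem_slitPlane {x y : ℂ} (hx : x ≠ 0) (hy : y ≠ 0) (h : x.arg ≠ y.arg) :
    -(x / y) ∈ slitPlane := by
  rw [mem_slitPlane_iff_arg]
  refine ⟨?_, neg_ne_zero.2 (div_ne_zero hx hy)⟩
  rw [arg_neg_div hx hy h, turn]
  have hx1 := neg_pi_lt_arg x
  have hx2 := arg_le_pi x
  have hy1 := neg_pi_lt_arg y
  have hy2 := arg_le_pi y
  split_ifs with hlt
  · push_cast; intro; linarith
  · push_cast; intro; linarith [Real.pi_pos]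

/-- The angle under which the segment from `a` to `b` is seen from `v`, or, when one of its ends is
`v`, from a point infinitely close to `v` in the direction `d`. -/
noncomputable def viewAngle (a b v d : ℂ) : ℝ :=
  if a = v then turn (b - v) d else if b = v then -turn (a - v) d else ((b - v) / (a - v)).arg

lemma tendsto_viewAngle {a b v d : ℂ} (hd : d ≠ 0) (hab : a ≠ b)
    (ha : a = v → (b - v).arg ≠ d.arg) (hb : b = v → (a - v).arg ≠ d.arg)
    (hv : v ∈ segment ℝ a b → a = v ∨ b = v) :
    Tendsto (fun s : ℝ => ((b - (v + s * d)) / (a - (v + s * d))).arg) (𝓝[>] 0)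
      (𝓝 (viewAngle a b v d)) := by
  have hlin : Tendsto (fun s : ℝ => v + s * d) (𝓝[>] 0) (𝓝 v) := by
    have : Continuous fun s : ℝ => v + s * d := by fun_prop
    simpa using (this.tendsto 0).mono_left nhdsWithin_le_nhds
  have hlin' : ∀ c, Tendsto (fun s : ℝ => c - (v + s * d)) (𝓝[>] 0) (𝓝 (c - v)) :=
    fun c => tendsto_const_nhds.sub hlin
  unfold viewAngle
  split_ifs with h1 h2
  · subst h1
    have hbv : b - a ≠ 0 := sub_ne_zero.2 hab.symm
    rw [← arg_neg_div hbv hd (ha rfl)]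
    refine (continuousAt_arg (neg_div_mem_slitPlane hbv hd (ha rfl))).tendsto.comp
      (Tendsto.congr' ?_ (((hlin' b).div_const d).neg)) |>.congr' ?_
      (f₁ := fun s : ℝ => (-((b - (a + s * d)) / d)).arg)
    · exact EventuallyEq.rfl
    · filter_upwards [self_mem_nhdsWithin] with s hs
      have hs : 0 < s := hs
      have e : (b - (a + s * d)) / (a - (a + s * d)) = ((s⁻¹ : ℝ) : ℂ) *
          (-((b - (a + s * d)) / d)) := by
        have : (s : ℂ) ≠ 0 := by exact_mod_cast hs.ne'
        push_cast
        rw [show a - (a + s * d) = -(s * d) by ring]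
        field_simp
      rw [e, arg_real_mul _ (inv_pos.2 hs)]
  · subst h2
    have hav : a - b ≠ 0 := sub_ne_zero.2 hab
    have hne := hb rfl
    rw [← turn_swap hne, ← arg_neg_div hd hav hne.symm]
    refine (continuousAt_arg (neg_div_mem_slitPlane hd hav hne.symm)).tendsto.comp
      ((tendsto_const_nhds (x := d)).div (hlin' a) hav).neg |>.congr' ?_
    filter_upwards [self_mem_nhdsWithin] with s hs
    have hs : 0 < s := hs
    have e : (b - (b + s * d)) / (a - (b + s * d)) = (s : ℂ) * -(d / (a - (b + s * d))) := by
      ring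
    rw [e, arg_real_mul _ hs]
    rfl
  · have hn : v ∉ segment ℝ a b := fun h => (hv h).elim h1 h2
    exact (continuousAt_arg (div_mem_slitPlane_of_notMem_segment hn)).tendsto.comp
      ((hlin' b).div (hlin' a) (sub_ne_zero.2 h1))

/-- The angles under which the segments of a polygonal line are seen from `p` add up, modulo full
turns, to the angle between its ends. -/
lemma coe_sum_arg_div (z : ℕ → ℂ) (p : ℂ) (n : ℕ) (h : ∀ k ≤ n, z k ≠ p) :
    ((∑ k ∈ range n, ((z (k + 1) - p) / (z k - p)).arg : ℝ) : Real.Angle) =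
      (z n - p).arg - (z 0 - p).arg := by
  induction n with
  | zero => simp
  | succ n ih =>
    rw [Finset.sum_range_succ, Real.Angle.coe_add, ih fun k hk => h k (by omega),
      arg_div_coe_angle (sub_ne_zero.2 (h _ le_rfl)) (sub_ne_zero.2 (h _ (by omega)))]
    abel

end Angles

/-! ### Winding numbers around a plane drawing -/

/-- A drawing of a graph in the complex plane with polygonal edges. The half-edges of the edge `e`
are `(e, false)` at its start and `(e, true)` at its end, and `vert` gives their vertices. -/
structure PolygonalNet (V Ed : Type*) where
  /-- The point that represents a vertex. -/
  pt : V → ℂ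
  /-- The number of segments of an edge. -/
  len : Ed → ℕ
  /-- The break points of an edge. -/
  node : Ed → ℕ → ℂ
  /-- The vertex of a half-edge. -/
  vert : Ed × Bool → V
  len_pos : ∀ e, 0 < len e
  node_zero : ∀ e, node e 0 = pt (vert (e, false))
  node_len : ∀ e, node e (len e) = pt (vert (e, true))
  node_ne : ∀ e, ∀ k < len e, node e k ≠ node e (k + 1)
  lineMap_notMem : ∀ e f, e ≠ f → ∀ j < len e, ∀ k < len f, ∀ t ∈ Set.Ioo (0 : ℝ) 1,
    AffineMap.lineMap (node e j) (node e (j + 1)) t ∉ segment ℝ (node f k) (node f (k + 1))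
  node_notMem : ∀ e f, e ≠ f → ∀ j, 0 < j → j < len e → ∀ k < len f,
    node e j ∉ segment ℝ (node f k) (node f (k + 1))
  pt_mem : ∀ x f, ∀ k < len f, pt x ∈ segment ℝ (node f k) (node f (k + 1)) →
    (k = 0 ∧ x = vert (f, false)) ∨ (k + 1 = len f ∧ x = vert (f, true))
  /-- Different half-edges at a vertex start in different directions. -/
  arg_ne : ∀ h h', h ≠ h' → vert h = vert h' →
    (if h.2 then node h.1 (len h.1 - 1) - node h.1 (len h.1) else
      node h.1 1 - node h.1 0).arg ≠
    (if h'.2 then node h'.1 (len h'.1 - 1) - node h'.1 (len h'.1) else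
      node h'.1 1 - node h'.1 0).arg

namespace PolygonalNet

open Filter Topology Complex

variable {V Ed : Type*} (N : PolygonalNet V Ed)

/-- The direction in which a half-edge leaves its vertex. -/
noncomputable def dir (h : Ed × Bool) : ℂ :=
  if h.2 then N.node h.1 (N.len h.1 - 1) - N.node h.1 (N.len h.1) else
    N.node h.1 1 - N.node h.1 0

/-- The argument of the direction of a half-edge. -/
noncomputable def angle (h : Ed × Bool) : ℝ := (N.dir h).arg

lemma angle_ne {h h' : Ed × Bool} (hne : h ≠ h') (hv : N.vert h = N.vert h') :
    N.angle h ≠ N.angle h' := N.arg_ne h h' hne hv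

lemma dir_ne_zero (h : Ed × Bool) : N.dir h ≠ 0 := by
  have := N.len_pos h.1
  unfold dir
  split_ifs
  · have h1 := N.node_ne h.1 (N.len h.1 - 1) (by omega)
    rw [Nat.sub_add_cancel this] at h1
    exact sub_ne_zero.2 h1
  · exact sub_ne_zero.2 (N.node_ne h.1 0 this).symm

lemma node_ne_pt {e : Ed} {k : ℕ} (hk : 0 < k) (hk' : k < N.len e) (x : V) :
    N.node e k ≠ N.pt x := by
  intro e'
  rcases N.pt_mem x e k hk' (e' ▸ left_mem_segment ℝ _ _) with h | h
  · omega
  · have h1 := N.pt_mem x e (k - 1) (by omega) (by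
      rw [Nat.sub_add_cancel hk, ← e']; exact right_mem_segment ℝ _ _)
    rcases h1 with h1 | h1
    · -- the edge would have two segments, both of them ending at the point of `x`
      have h2 := N.node_ne e k hk'
      rw [h.1, N.node_len, ← h.2] at h2
      exact h2 e'
    · omega

lemma eq_start_of_node_eq {f : Ed} {k : ℕ} (hk : k < N.len f) {x : V}
    (h : N.node f k = N.pt x) : k = 0 ∧ N.vert (f, false) = x := by
  obtain rfl : k = 0 := by
    by_contra hk0
    exact N.node_ne_pt (Nat.pos_of_ne_zero hk0) hk x h
  rcases N.pt_mem x f 0 hk (h ▸ left_mem_segment ℝ _ _) with h1 | h1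
  · exact ⟨rfl, h1.2.symm⟩
  · have h2 := N.node_ne f 0 hk
    rw [h1.1, N.node_len, ← h1.2] at h2
    exact absurd h h2

lemma eq_end_of_node_eq {f : Ed} {k : ℕ} (hk : k < N.len f) {x : V}
    (h : N.node f (k + 1) = N.pt x) : k + 1 = N.len f ∧ N.vert (f, true) = x := by
  have hk1 : k + 1 = N.len f := by
    by_contra hk0
    exact N.node_ne_pt (Nat.succ_pos k) (by omega) x h
  rcases N.pt_mem x f k hk (h ▸ right_mem_segment ℝ _ _) with h1 | h1
  · have h2 := N.node_ne f k hk
    rw [h, h1.1, N.node_zero, ← h1.2] at h2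
    exact absurd rfl h2
  · exact ⟨hk1, h1.2.symm⟩

variable [Fintype Ed]

/-- The winding number (times `2π`) around `p` of a chain of edges. -/
noncomputable def winding (c : Ed → ℤ) (p : ℂ) : ℝ :=
  ∑ f, c f * ∑ k ∈ range (N.len f),
    ((N.node f (k + 1) - p) / (N.node f k - p)).arg

/-- The point `p` does not lie on the chain `c`. -/
def Off (c : Ed → ℤ) (p : ℂ) : Prop :=
  ∀ f, c f ≠ 0 → ∀ k < N.len f, p ∉ segment ℝ (N.node f k) (N.node f (k + 1))

lemma coe_winding [Fintype V] [DecidableEq V] {c : Ed → ℤ}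
    (hc : ∀ x, ∑ f, c f * ((if N.vert (f, true) = x then 1 else 0) -
      if N.vert (f, false) = x then 1 else 0) = 0) {p : ℂ} (hp : N.Off c p) :
    (N.winding c p : Real.Angle) = 0 := by
  have h1 : ∀ f, ((c f * ∑ k ∈ range (N.len f),
      ((N.node f (k + 1) - p) / (N.node f k - p)).arg : ℝ) : Real.Angle) =
      ∑ x, (c f * ((if N.vert (f, true) = x then 1 else 0) -
        if N.vert (f, false) = x then 1 else 0)) • ((N.pt x - p).arg : Real.Angle) := by
    intro f
    by_cases hf : c f = 0
    · simp [hf]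
    · have hne : ∀ k ≤ N.len f, N.node f k ≠ p := by
        intro k hk e
        rcases hk.lt_or_eq with hk | rfl
        · exact hp f hf k hk (e ▸ left_mem_segment ℝ _ _)
        · refine hp f hf (N.len f - 1) (by have := N.len_pos f; omega) ?_
          rw [Nat.sub_add_cancel (N.len_pos f), ← e]
          exact right_mem_segment ℝ _ _
      have h2 := coe_sum_arg_div (N.node f) p (N.len f) hne
      rw [← zsmul_eq_mul, Real.Angle.coe_zsmul, h2, N.node_zero, N.node_len]
      simp [mul_smul, sub_smul, ← Finset.smul_sum, Finset.sum_sub_distrib, ite_smul]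
  have h3 : (N.winding c p : Real.Angle) = ∑ f, ((c f * ∑ k ∈ range (N.len f),
      ((N.node f (k + 1) - p) / (N.node f k - p)).arg : ℝ) : Real.Angle) := by
    rw [winding]; exact map_sum Real.Angle.coeHom _ _
  rw [h3, Finset.sum_congr rfl fun f _ => h1 f, Finset.sum_comm]
  refine Finset.sum_eq_zero fun x _ => ?_
  rw [← Finset.sum_smul, hc x, zero_smul]

lemma continuousAt_winding {c : Ed → ℤ} {p : ℂ} (hp : N.Off c p) :
    ContinuousAt (N.winding c) p := by
  unfold winding
  refine tendsto_finsetSum _ fun f _ => ?_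
  by_cases hf : c f = 0
  · simp only [hf, Int.cast_zero, zero_mul]; exact tendsto_const_nhds
  refine Tendsto.const_mul _ (tendsto_finsetSum _ fun k hk => ?_)
  have hk := hp f hf k (Finset.mem_range.1 hk)
  have ha : N.node f k - p ≠ 0 := fun e =>
    hk (by rw [← sub_eq_zero.1 e]; exact left_mem_segment ℝ _ _)
  refine (continuousAt_arg (div_mem_slitPlane_of_notMem_segment hk)).tendsto.comp ?_
  exact (tendsto_const_nhds.sub tendsto_id).div (tendsto_const_nhds.sub tendsto_id) ha

/-- The winding number is constant on segments that do not meet the chain. -/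
lemma winding_eq_of_segment [Fintype V] [DecidableEq V] {c : Ed → ℤ}
    (hc : ∀ x, ∑ f, c f * ((if N.vert (f, true) = x then 1 else 0) -
      if N.vert (f, false) = x then 1 else 0) = 0) {p q : ℂ}
    (hpq : ∀ r ∈ segment ℝ p q, N.Off c r) : N.winding c p = N.winding c q := by
  have hpre : IsPreconnected (segment ℝ p q) := (convex_segment p q).isPreconnected
  have hval : ∀ r ∈ segment ℝ p q, ∃ n : ℤ, N.winding c r = n * (2 * Real.pi) := by
    intro r hr
    have := N.coe_winding hc (hpq r hr)
    rw [Real.Angle.coe_eq_zero_iff] at this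
    obtain ⟨n, hn⟩ := this
    exact ⟨n, by rw [← hn, zsmul_eq_mul]⟩
  have hcont : ContinuousOn (fun r => N.winding c r / (2 * Real.pi)) (segment ℝ p q) :=
    fun r hr => ((N.continuousAt_winding (hpq r hr)).div_const _).continuousWithinAt
  have := hpre.constant_of_mapsTo (T := Set.range ((↑) : ℤ → ℝ))
    Int.isClosedEmbedding_coe_real.isEmbedding.isInducing.isDiscrete_range hcont (by
      intro r hr
      obtain ⟨n, hn⟩ := hval r hr
      exact ⟨n, by simp only [hn]; field_simp⟩) (left_mem_segment ℝ p q) (right_mem_segment ℝ p q)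
  have hpi := Real.pi_pos
  field_simp at this
  linarith

/-! ### Jumps of the winding number at the vertices -/

/-- A chain of edges, given by its coefficients on the half-edges, that is a cycle. -/
def IsCycle [DecidableEq V] (c : Ed × Bool → ℤ) : Prop :=
  (∀ f, c (f, true) = -c (f, false)) ∧ ∀ x, ∑ h, (if N.vert h = x then c h else 0) = 0

variable {N}

lemma IsCycle.boundary [DecidableEq V] {c : Ed × Bool → ℤ} (hc : N.IsCycle c) (x : V) :
    ∑ f, c (f, false) * ((if N.vert (f, true) = x then 1 else 0) -
      if N.vert (f, false) = x then 1 else 0) = 0 := by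
  have h := hc.2 x
  rw [Fintype.sum_prod_type] at h
  rw [← neg_eq_zero, ← Finset.sum_neg_distrib]
  refine Eq.trans (Finset.sum_congr rfl fun f _ => ?_) h
  rw [Fintype.sum_bool, hc.1]
  split_ifs <;> ring

omit [Fintype Ed] in
lemma off_lineMap {c : Ed × Bool → ℤ} {e : Ed} (he : c (e, false) = 0) {j : ℕ}
    (hj : j < N.len e) {t : ℝ} (ht : t ∈ Set.Icc (0 : ℝ) 1) (h0 : t = 0 → 0 < j)
    (h1 : t = 1 → j + 1 < N.len e) :
    N.Off (fun f => c (f, false))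
      (AffineMap.lineMap (N.node e j) (N.node e (j + 1)) t) := by
  intro f hf k hk
  have hef : e ≠ f := by rintro rfl; exact hf he
  rcases ht.1.eq_or_lt with rfl | ht0
  · rw [AffineMap.lineMap_apply_zero]
    exact N.node_notMem e f hef j (h0 rfl) hj k hk
  rcases ht.2.eq_or_lt with rfl | ht1
  · rw [AffineMap.lineMap_apply_one]
    exact N.node_notMem e f hef (j + 1) (Nat.succ_pos j) (h1 rfl) k hk
  · exact N.lineMap_notMem e f hef j hj k hk t ⟨ht0, ht1⟩

variable [Fintype V] [DecidableEq V] {c : Ed × Bool → ℤ} (hc : N.IsCycle c)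
  {e : Ed} (he : c (e, false) = 0)
include hc he

lemma winding_lineMap_eq {j : ℕ} (hj : j < N.len e) {s t : ℝ} (hs : s ∈ Set.Icc (0 : ℝ) 1)
    (ht : t ∈ Set.Icc (0 : ℝ) 1) (hs0 : s = 0 → 0 < j) (hs1 : s = 1 → j + 1 < N.len e)
    (ht0 : t = 0 → 0 < j) (ht1 : t = 1 → j + 1 < N.len e) :
    N.winding (fun f => c (f, false)) (AffineMap.lineMap (N.node e j) (N.node e (j + 1)) s) =
    N.winding (fun f => c (f, false)) (AffineMap.lineMap (N.node e j) (N.node e (j + 1)) t) := by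
  refine N.winding_eq_of_segment hc.boundary fun r hr => ?_
  rw [← image_segment, segment_eq_uIcc] at hr
  obtain ⟨u, hu, rfl⟩ := hr
  rw [Set.mem_uIcc] at hu
  refine off_lineMap he hj ?_ ?_ ?_
  · rcases hu with hu | hu
    · exact ⟨hs.1.trans hu.1, hu.2.trans ht.2⟩
    · exact ⟨ht.1.trans hu.1, hu.2.trans hs.2⟩
  · rintro rfl
    rcases hu with hu | hu
    · exact hs0 (le_antisymm hu.1 hs.1)
    · exact ht0 (le_antisymm hu.1 ht.1)
  · rintro rfl
    rcases hu with hu | hu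
    · exact ht1 (le_antisymm ht.2 hu.2)
    · exact hs1 (le_antisymm hs.2 hu.2)

/-- The winding number of a cycle is constant along an edge that does not belong to it. -/
lemma winding_edge {j : ℕ} (hj : j < N.len e) {t : ℝ} (ht : t ∈ Set.Ioo (0 : ℝ) 1) :
    N.winding (fun f => c (f, false)) (AffineMap.lineMap (N.node e j) (N.node e (j + 1)) t) =
    N.winding (fun f => c (f, false))
      (AffineMap.lineMap (N.node e 0) (N.node e 1) (1 / 2 : ℝ)) := by
  have hhalf : (1 / 2 : ℝ) ∈ Set.Icc (0 : ℝ) 1 := by constructor <;> norm_num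
  induction j generalizing t with
  | zero =>
    exact winding_lineMap_eq hc he hj ⟨ht.1.le, ht.2.le⟩ hhalf (fun h => absurd h ht.1.ne')
      (fun h => absurd h ht.2.ne) (fun h => by norm_num at h) (fun h => by norm_num at h)
  | succ j ih =>
    rw [← ih (by omega) ht]
    have h1 := winding_lineMap_eq hc he (j := j) (by omega) ⟨ht.1.le, ht.2.le⟩
      (t := 1) (by simp) (fun h => absurd h ht.1.ne') (fun _ => hj) (by simp) (fun _ => hj)
    have h2 := winding_lineMap_eq hc he (j := j + 1) (by omega) ⟨ht.1.le, ht.2.le⟩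
      (t := 0) (by simp) (fun _ => Nat.succ_pos j) (fun h => absurd h ht.2.ne)
      (fun _ => Nat.succ_pos j) (by simp)
    rw [h1, h2, AffineMap.lineMap_apply_zero, AffineMap.lineMap_apply_one]

lemma winding_pt_add_mul_dir (b : Bool) {s : ℝ} (hs : s ∈ Set.Ioo (0 : ℝ) 1) :
    N.winding (fun f => c (f, false)) (N.pt (N.vert (e, b)) + s * N.dir (e, b)) =
    N.winding (fun f => c (f, false))
      (AffineMap.lineMap (N.node e 0) (N.node e 1) (1 / 2 : ℝ)) := by
  have hpos := N.len_pos e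
  cases b
  · rw [← winding_edge hc he (j := 0) hpos hs]
    congr 1
    simp only [dir, ← N.node_zero, AffineMap.lineMap_apply, vsub_eq_sub, vadd_eq_add,
      Complex.real_smul, Bool.false_eq_true, if_false]
    ring
  · rw [← winding_edge hc he (j := N.len e - 1) (by omega) (t := 1 - s)
      ⟨by linarith [hs.2], by linarith [hs.1]⟩]
    congr 1
    simp only [dir, ← N.node_len, AffineMap.lineMap_apply, vsub_eq_sub, vadd_eq_add,
      Complex.real_smul, if_true, Nat.sub_add_cancel hpos]
    push_cast
    ring

omit [Fintype Ed] [Fintype V] hc he in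
/-- The contribution of the edge `f` to the winding number near the vertex `x`. The first sum does
not depend on the direction `d` in which `x` is approached. -/
lemma sum_viewAngle (f : Ed) (x : V) (d : ℂ) :
    ∑ k ∈ range (N.len f), viewAngle (N.node f k) (N.node f (k + 1)) (N.pt x) d =
      ∑ k ∈ range (N.len f), (if N.node f k = N.pt x ∨ N.node f (k + 1) = N.pt x then 0 else
        ((N.node f (k + 1) - N.pt x) / (N.node f k - N.pt x)).arg) +
      (if N.vert (f, false) = x then turn (N.dir (f, false)) d else 0) -
      (if N.vert (f, true) = x then turn (N.dir (f, true)) d else 0) := by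
  have hpos := N.len_pos f
  have h1 : ∑ k ∈ range (N.len f), (if N.node f k = N.pt x then
      turn (N.node f (k + 1) - N.pt x) d else 0) =
      if N.vert (f, false) = x then turn (N.dir (f, false)) d else 0 := by
    rw [Finset.sum_eq_single 0]
    · by_cases hx : N.vert (f, false) = x
      · have : N.node f 0 = N.pt x := by rw [N.node_zero, hx]
        rw [if_pos this, if_pos hx, ← this]
        simp [dir]
      · rw [if_neg hx, if_neg fun h => hx (N.eq_start_of_node_eq hpos h).2]
    · intro k hk hk0
      exact if_neg fun h => hk0 (N.eq_start_of_node_eq (Finset.mem_range.1 hk) h).1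
    · intro h; exact absurd (Finset.mem_range.2 hpos) h
  have h2 : ∑ k ∈ range (N.len f), (if N.node f (k + 1) = N.pt x then
      turn (N.node f k - N.pt x) d else 0) =
      if N.vert (f, true) = x then turn (N.dir (f, true)) d else 0 := by
    rw [Finset.sum_eq_single (N.len f - 1)]
    · by_cases hx : N.vert (f, true) = x
      · have : N.node f (N.len f) = N.pt x := by rw [N.node_len, hx]
        rw [Nat.sub_add_cancel hpos, if_pos this, if_pos hx, ← this]
        simp [dir]
      · rw [if_neg hx, if_neg fun h => hx (N.eq_end_of_node_eq (by omega) h).2]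
    · intro k hk hk0
      refine if_neg fun h => hk0 ?_
      have := (N.eq_end_of_node_eq (Finset.mem_range.1 hk) h).1
      omega
    · intro h; exact absurd (Finset.mem_range.2 (by omega)) h
  rw [← h1, ← h2, ← Finset.sum_add_distrib, ← Finset.sum_sub_distrib]
  refine Finset.sum_congr rfl fun k hk => ?_
  have hne := N.node_ne f k (Finset.mem_range.1 hk)
  unfold viewAngle
  by_cases ha : N.node f k = N.pt x
  · have hb : N.node f (k + 1) ≠ N.pt x := fun h => hne (ha.trans h.symm)
    simp [ha, hb]
  · by_cases hb : N.node f (k + 1) = N.pt x <;> simp [ha, hb]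

omit [Fintype V] [DecidableEq V] hc he in
/-- The winding number of a chain `c` near the vertex `x`, when `x` is approached along a half-edge
that does not belong to the chain. -/
lemma tendsto_winding {x : V} {h : Ed × Bool} (hx : N.vert h = x) (hh : c (h.1, false) = 0) :
    Tendsto (fun s : ℝ => N.winding (fun f => c (f, false)) (N.pt x + s * N.dir h)) (𝓝[>] 0)
      (𝓝 (∑ f, c (f, false) * ∑ k ∈ range (N.len f),
        viewAngle (N.node f k) (N.node f (k + 1)) (N.pt x) (N.dir h))) := by
  unfold winding
  refine tendsto_finsetSum _ fun f _ => ?_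
  by_cases hf : c (f, false) = 0
  · simp only [hf, Int.cast_zero, zero_mul]; exact tendsto_const_nhds
  have hne : ∀ b, (f, b) ≠ h := by rintro b rfl; exact hf hh
  refine Tendsto.const_mul _ (tendsto_finsetSum _ fun k hk => ?_)
  have hk := Finset.mem_range.1 hk
  refine tendsto_viewAngle (N.dir_ne_zero h) (N.node_ne f k hk) ?_ ?_ ?_
  · intro e
    obtain ⟨rfl, hv⟩ := N.eq_start_of_node_eq hk e
    rw [← e]
    exact N.angle_ne (hne false) (hv.trans hx.symm)
  · intro e
    obtain ⟨hk1, hv⟩ := N.eq_end_of_node_eq hk e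
    have := N.angle_ne (hne true) (hv.trans hx.symm)
    simp only [angle, dir, if_true, ← hk1, Nat.add_sub_cancel] at this
    rw [← e]
    exact this
  · intro hm
    rcases N.pt_mem x f k hk hm with h1 | h1
    · left; rw [h1.1, h1.2, N.node_zero]
    · right; rw [h1.1, h1.2, N.node_len]

/-- The winding number of a cycle along an edge `e` outside it, computed from the order of the
half-edges around one of the ends of `e`. -/
lemma winding_eq_sub_sum (b : Bool) : N.winding (fun f => c (f, false))
      (AffineMap.lineMap (N.node e 0) (N.node e 1) (1 / 2 : ℝ)) =
    (∑ f, c (f, false) * ∑ k ∈ range (N.len f),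
      (if N.node f k = N.pt (N.vert (e, b)) ∨ N.node f (k + 1) = N.pt (N.vert (e, b)) then 0 else
        ((N.node f (k + 1) - N.pt (N.vert (e, b))) / (N.node f k - N.pt (N.vert (e, b)))).arg) +
      ∑ h, (if N.vert h = N.vert (e, b) then c h * N.angle h else 0)) -
    Real.pi * (∑ h, (if N.vert h = N.vert (e, b) then
      c h * (if N.angle h < N.angle (e, b) then -1 else 1) else 0 : ℤ)) := by
  have h1 := tendsto_winding (N := N) (c := c) (x := N.vert (e, b)) (h := (e, b)) rfl he
  have h2 : Tendsto (fun s : ℝ => N.winding (fun f => c (f, false))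
      (N.pt (N.vert (e, b)) + s * N.dir (e, b))) (𝓝[>] 0) (𝓝 (N.winding (fun f => c (f, false))
      (AffineMap.lineMap (N.node e 0) (N.node e 1) (1 / 2 : ℝ)))) := by
    refine tendsto_const_nhds.congr' ?_
    filter_upwards [Ioo_mem_nhdsGT (show (0 : ℝ) < 1 by norm_num)] with s hs
    exact (winding_pt_add_mul_dir hc he b hs).symm
  rw [tendsto_nhds_unique h2 h1]
  have h3 : ∑ h, (if N.vert h = N.vert (e, b) then (c h : ℝ) else 0) = 0 := by
    exact_mod_cast hc.2 (N.vert (e, b))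
  have h4 : ∑ h, (if N.vert h = N.vert (e, b) then (c h : ℝ) * turn (N.dir h) (N.dir (e, b))
      else 0) = ∑ h, (if N.vert h = N.vert (e, b) then c h * N.angle h else 0) -
    Real.pi * (∑ h, (if N.vert h = N.vert (e, b) then
      c h * (if N.angle h < N.angle (e, b) then -1 else 1) else 0 : ℤ)) := by
    have h5 : ∑ h, (if N.vert h = N.vert (e, b) then (c h : ℝ) else 0) *
        -N.angle (e, b) = 0 := by
      rw [← Finset.sum_mul, h3, zero_mul]
    push_cast
    rw [Finset.mul_sum, ← Finset.sum_sub_distrib, ← sub_eq_zero, ← Finset.sum_sub_distrib]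
    refine (Finset.sum_congr rfl fun h _ => ?_).trans h5
    by_cases hv : N.vert h = N.vert (e, b)
    · have ht : turn (N.dir h) (N.dir (e, b)) = N.angle h - N.angle (e, b) -
          Real.pi * (if N.angle h < N.angle (e, b) then -1 else 1 : ℤ) := rfl
      simp only [if_pos hv, ht]; push_cast; ring
    · simp [if_neg hv]
  rw [add_sub_assoc, ← h4, Fintype.sum_prod_type, ← Finset.sum_add_distrib]
  refine Finset.sum_congr rfl fun f _ => ?_
  rw [sum_viewAngle, Fintype.sum_bool, hc.1]
  push_cast
  split_ifs <;> ring

omit he in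
/-- The intersection number of two cycles without common edges in a plane drawing vanishes: the
winding number of the one returns to its initial value along the other. -/
theorem intersection_eq_zero {c' : Ed × Bool → ℤ} (hc' : N.IsCycle c')
    (hcc' : ∀ f, c (f, false) = 0 ∨ c' (f, false) = 0) :
    ∑ h', ∑ h, (if N.vert h = N.vert h' then
      c h * c' h' * (if N.angle h < N.angle h' then -1 else 1) else 0) = 0 := by
  obtain ⟨ω, hω⟩ : ∃ ω : Ed → ℝ, ∀ e, ω e = N.winding (fun f => c (f, false))
      (AffineMap.lineMap (N.node e 0) (N.node e 1) (1 / 2 : ℝ)) := ⟨_, fun _ => rfl⟩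
  obtain ⟨κ, hκ⟩ : ∃ κ : V → ℝ, ∀ x, κ x = ∑ f, c (f, false) * ∑ k ∈ range (N.len f),
      (if N.node f k = N.pt x ∨ N.node f (k + 1) = N.pt x then 0 else
        ((N.node f (k + 1) - N.pt x) / (N.node f k - N.pt x)).arg) +
      ∑ h, (if N.vert h = x then c h * N.angle h else 0) := ⟨_, fun _ => rfl⟩
  have h1 : ∀ h', (c' h' : ℝ) * ω h'.1 = c' h' * κ (N.vert h') -
      Real.pi * (∑ h, (if N.vert h = N.vert h' then
      c h * c' h' * (if N.angle h < N.angle h' then -1 else 1) else 0) : ℤ) := by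
    rintro ⟨e, b⟩
    rcases hcc' e with h0 | h0
    · rw [hω, winding_eq_sub_sum hc h0 b, ← hκ]
      push_cast
      rw [mul_sub, mul_left_comm, Finset.mul_sum]
      congr 2
      refine Finset.sum_congr rfl fun h _ => ?_
      split_ifs <;> ring
    · have h0' : c' (e, b) = 0 := by cases b <;> simp [hc'.1, h0]
      simp [h0']
  have h2 : ∑ h', (c' h' : ℝ) * ω h'.1 = 0 := by
    rw [Fintype.sum_prod_type]
    refine Finset.sum_eq_zero fun e _ => ?_
    rw [Fintype.sum_bool, hc'.1]
    push_cast
    ring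
  have h3 : ∑ h', (c' h' : ℝ) * κ (N.vert h') = 0 := by
    have : ∀ h', (c' h' : ℝ) * κ (N.vert h') =
        ∑ x, (if N.vert h' = x then (c' h' : ℝ) else 0) * κ x := by
      intro h'
      simp [ite_mul]
    rw [Finset.sum_congr rfl fun h' _ => this h', Finset.sum_comm]
    refine Finset.sum_eq_zero fun x _ => ?_
    rw [← Finset.sum_mul]
    have h4 : ∑ h, (if N.vert h = x then (c' h : ℝ) else 0) = 0 := by
      exact_mod_cast hc'.2 x
    rw [h4, zero_mul]
  rw [Finset.sum_congr rfl fun h' _ => h1 h', Finset.sum_sub_distrib, h3, zero_sub,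
    neg_eq_zero, ← Finset.mul_sum, mul_eq_zero, or_iff_right Real.pi_ne_zero] at h2
  exact_mod_cast h2

end PolygonalNet

end FourValentMap

namespace Graph

open Finset

variable {α β : Type*}

/-! ### Degrees and half-edges -/

/-- The degree of a vertex, counted along an orientation of the edges. -/
lemma degree_eq_ncard_add_ncard {G : Graph α β} (hE : G.edgeSet.Finite) {src tgt : β → α}
    (hl : ∀ e ∈ G.edgeSet, G.IsLink e (src e) (tgt e)) (x : α) :
    G.degree x = {e ∈ G.edgeSet | src e = x}.ncard + {e ∈ G.edgeSet | tgt e = x}.ncard := by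
  have hfin : ∀ p : β → Prop, {e ∈ G.edgeSet | p e}.Finite := fun p => hE.subset fun e he => he.1
  have h1 : {e ∈ G.edgeSet | src e = x} =
      {e ∈ G.edgeSet | src e = x ∧ tgt e ≠ x} ∪ {e ∈ G.edgeSet | src e = x ∧ tgt e = x} := by
    ext e; simp only [Set.mem_ofPred_eq, Set.mem_union]; tauto
  have h2 : {e ∈ G.edgeSet | tgt e = x} =
      {e ∈ G.edgeSet | src e ≠ x ∧ tgt e = x} ∪ {e ∈ G.edgeSet | src e = x ∧ tgt e = x} := by
    ext e; simp only [Set.mem_ofPred_eq, Set.mem_union]; tauto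
  have h3 : {e | G.IsNonloopAt e x} =
      {e ∈ G.edgeSet | src e = x ∧ tgt e ≠ x} ∪ {e ∈ G.edgeSet | src e ≠ x ∧ tgt e = x} := by
    ext e
    simp only [Set.mem_ofPred_eq, Set.mem_union]
    constructor
    · rintro ⟨y, hy, hxy⟩
      have he := hxy.edge_mem
      rcases (hl e he).eq_and_eq_or_eq_and_eq hxy with ⟨a, b⟩ | ⟨a, b⟩
      · exact Or.inl ⟨he, a, by rwa [b]⟩
      · exact Or.inr ⟨he, by rwa [a], b⟩
    · rintro (⟨he, rfl, h⟩ | ⟨he, h, rfl⟩)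
      · exact ⟨_, h, hl e he⟩
      · exact ⟨_, h, (hl e he).symm⟩
  have h4 : {e | G.IsLoopAt e x} = {e ∈ G.edgeSet | src e = x ∧ tgt e = x} := by
    ext e
    simp only [Set.mem_ofPred_eq]
    constructor
    · intro h
      have he : e ∈ G.edgeSet := h.edge_mem
      rcases (hl e he).eq_and_eq_or_eq_and_eq h with h' | h' <;> exact ⟨he, h'⟩
    · rintro ⟨he, h, h'⟩
      have := hl e he
      rwa [h, h'] at this
  rw [degree, h1, h2, h3, h4, Set.ncard_union_eq _ (hfin _) (hfin _),
    Set.ncard_union_eq _ (hfin _) (hfin _), Set.ncard_union_eq _ (hfin _) (hfin _)]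
  · ring
  all_goals
    rw [Set.disjoint_left]
    rintro e ⟨_, h, h'⟩ ⟨_, h'', h'''⟩
    tauto

/-! ### From plane drawings to nets in the complex plane -/

lemma polyline_add (q : ℕ → EuclideanSpace ℝ (Fin 2)) (k : ℕ) {t : ℝ}
    (ht : t ∈ Set.Icc (0 : ℝ) 1) :
    polyline q (k + t) = AffineMap.lineMap (q k) (q (k + 1)) t := by
  rcases ht.2.eq_or_lt with rfl | h1
  · have : ⌊(k : ℝ) + 1⌋₊ = k + 1 := by
      exact_mod_cast Nat.floor_natCast (R := ℝ) (k + 1)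
    simp [polyline, this]
  · have : ⌊(k : ℝ) + t⌋₊ = k := by
      rw [Nat.floor_eq_iff (by have := ht.1; positivity)]
      constructor <;> linarith [ht.1]
    simp [polyline, this]

lemma polyline_natCast (q : ℕ → EuclideanSpace ℝ (Fin 2)) (k : ℕ) :
    polyline q k = q k := by
  simpa using polyline_add q k (t := 0) (by simp)

namespace PlaneDrawing

variable {G : Graph α β} (D : G.PlaneDrawing)

lemma polyline_ne_polyline {e f : β} (he : e ∈ G.edgeSet) (hf : f ∈ G.edgeSet) (hef : e ≠ f)
    {s u : ℝ} (hs : s ∈ Set.Ioo 0 (D.len e : ℝ)) (hu : u ∈ Set.Icc 0 (D.len f : ℝ)) :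
    polyline (D.node e) s ≠ polyline (D.node f) u := by
  obtain ⟨x, y, hxy, h0, h1⟩ := D.joins f hf
  rcases hu.1.eq_or_lt with rfl | hu0
  · have := polyline_natCast (D.node f) 0
    rw [Nat.cast_zero] at this
    rw [this, h0]
    exact D.edge_ne_point e he x hxy.left_mem s hs
  rcases hu.2.eq_or_lt with rfl | hu1
  · rw [polyline_natCast, h1]
    exact D.edge_ne_point e he y hxy.right_mem s hs
  · exact D.edge_ne_edge e he f hf hef s hs u ⟨hu0, hu1⟩

lemma node_ne_node_succ {e : β} (he : e ∈ G.edgeSet) {k : ℕ} (hk : k < D.len e) :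
    D.node e k ≠ D.node e (k + 1) := by
  intro h
  have hk' : (k : ℝ) + 1 ≤ D.len e := by exact_mod_cast hk
  have hk0 : (0 : ℝ) ≤ k := Nat.cast_nonneg k
  have h1 := polyline_add (D.node e) k (t := 1 / 3) (by constructor <;> norm_num)
  have h2 := polyline_add (D.node e) k (t := 2 / 3) (by constructor <;> norm_num)
  rw [← h, AffineMap.lineMap_same_apply] at h1 h2
  have := D.edge_injOn e he (x₁ := (k : ℝ) + 1 / 3) (x₂ := (k : ℝ) + 2 / 3)
    ⟨by linarith, by linarith⟩ ⟨by linarith, by linarith⟩ (h1.trans h2.symm)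
  linarith

/-- The Euclidean plane as the complex plane. -/
noncomputable def toComplex : EuclideanSpace ℝ (Fin 2) ≃ₗᵢ[ℝ] ℂ :=
  Complex.orthonormalBasisOneI.repr.symm

lemma toComplex_lineMap (a b : EuclideanSpace ℝ (Fin 2)) (t : ℝ) :
    toComplex (AffineMap.lineMap a b t) = AffineMap.lineMap (toComplex a) (toComplex b) t := by
  simp [AffineMap.lineMap_apply_module']

/-- The points of a closed segment of an edge. -/
lemma exists_polyline_eq_of_mem_segment {f : β} {k : ℕ} (hk : k < D.len f) {p : ℂ}
    (hp : p ∈ segment ℝ (toComplex (D.node f k)) (toComplex (D.node f (k + 1)))) :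
    ∃ t ∈ Set.Icc (0 : ℝ) 1, (k : ℝ) + t ∈ Set.Icc (0 : ℝ) (D.len f) ∧
      p = toComplex (polyline (D.node f) (k + t)) := by
  rw [segment_eq_image_lineMap] at hp
  obtain ⟨t, ht, rfl⟩ := hp
  have hk' : (k : ℝ) + 1 ≤ D.len f := by exact_mod_cast hk
  have hk0 : (0 : ℝ) ≤ k := Nat.cast_nonneg k
  refine ⟨t, ht, ⟨by linarith [ht.1], by linarith [ht.2]⟩, ?_⟩
  rw [polyline_add _ _ ht, toComplex_lineMap]

section Net

variable (vert : G.edgeSet × Bool → G.vertexSet)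
  (h0 : ∀ e : G.edgeSet, D.node e 0 = D.point (vert (e, false)))
  (h1 : ∀ e : G.edgeSet, D.node e (D.len e) = D.point (vert (e, true)))

include h0 h1 in
/-- The points of an edge that are close to its ends. -/
lemma toComplex_polyline_eq (h : G.edgeSet × Bool) {s : ℝ} (hs : s ∈ Set.Icc (0 : ℝ) 1) :
    toComplex (polyline (D.node h.1) (if h.2 then D.len h.1 - s else s)) =
      toComplex (D.point (vert h)) + s * (if h.2 then
        toComplex (D.node h.1 (D.len h.1 - 1)) - toComplex (D.node h.1 (D.len h.1)) else
      toComplex (D.node h.1 1) - toComplex (D.node h.1 0)) := by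
  obtain ⟨e, b⟩ := h
  have hpos := D.len_pos e e.2
  cases b
  · have := polyline_add (D.node e) 0 hs
    simp only [Nat.cast_zero, zero_add] at this
    simp only [Bool.false_eq_true, if_false, this, toComplex_lineMap, ← h0]
    simp only [AffineMap.lineMap_apply_module', Complex.real_smul]
    ring
  · have := polyline_add (D.node e) (D.len e - 1) (t := 1 - s) ⟨by linarith [hs.2],
      by linarith [hs.1]⟩
    rw [Nat.cast_sub hpos, Nat.sub_add_cancel hpos,
      show ((D.len e : ℝ) - (1 : ℕ) + (1 - s)) = D.len e - s by push_cast; ring] at this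
    simp only [if_true, this, toComplex_lineMap, ← h1]
    simp only [AffineMap.lineMap_apply_module', Complex.real_smul]
    push_cast
    ring

/-- A plane drawing as a net in the complex plane. -/
noncomputable def toNet : FourValentMap.PolygonalNet G.vertexSet G.edgeSet where
  pt x := toComplex (D.point x)
  len e := D.len e
  node e k := toComplex (D.node e k)
  vert := vert
  len_pos e := D.len_pos e e.2
  node_zero e := by rw [h0]
  node_len e := by rw [h1]
  node_ne e k hk h := D.node_ne_node_succ e.2 hk (toComplex.injective h)
  lineMap_notMem e f hef j hj k hk t ht hm := by
    obtain ⟨s, hs, hks, h⟩ := D.exists_polyline_eq_of_mem_segment hk hm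
    rw [← toComplex_lineMap, ← polyline_add _ _ ⟨ht.1.le, ht.2.le⟩] at h
    have hj' : (j : ℝ) + 1 ≤ D.len e := by exact_mod_cast hj
    have hj0 : (0 : ℝ) ≤ j := Nat.cast_nonneg j
    exact D.polyline_ne_polyline e.2 f.2 (fun h => hef (Subtype.ext h))
      ⟨by linarith [ht.1], by linarith [ht.2]⟩ hks (toComplex.injective h)
  node_notMem e f hef j hj hj' k hk hm := by
    obtain ⟨s, hs, hks, h⟩ := D.exists_polyline_eq_of_mem_segment hk hm
    rw [← polyline_natCast (D.node e) j] at h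
    exact D.polyline_ne_polyline e.2 f.2 (fun h => hef (Subtype.ext h))
      ⟨by exact_mod_cast hj, by exact_mod_cast hj'⟩ hks (toComplex.injective h)
  pt_mem x f k hk hm := by
    obtain ⟨s, hs, hks, h⟩ := D.exists_polyline_eq_of_mem_segment hk hm
    have h := toComplex.injective h
    have hk0 : (0 : ℝ) ≤ k := Nat.cast_nonneg k
    have hk1 : (k : ℝ) + 1 ≤ D.len f := by exact_mod_cast hk
    rcases hks.1.eq_or_lt with h2 | h2
    · have hs0 : s = 0 := by linarith [hs.1]
      have hk0 : (k : ℝ) = 0 := by linarith [hs.1]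
      have hk0 : k = 0 := by exact_mod_cast hk0
      subst hs0 hk0
      left
      rw [add_zero, polyline_natCast, h0] at h
      exact ⟨rfl, Subtype.ext (D.point_injOn x.2 (vert (f, false)).2 h)⟩
    rcases hks.2.eq_or_lt with h3 | h3
    · right
      rw [h3, polyline_natCast, h1] at h
      refine ⟨?_, Subtype.ext (D.point_injOn x.2 (vert (f, true)).2 h)⟩
      have : (k : ℝ) + 1 = D.len f := by linarith [hs.2]
      exact_mod_cast this
    · exact absurd h.symm (D.edge_ne_point f f.2 x x.2 _ ⟨h2, h3⟩)
  arg_ne h h' hne hv harg := by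
    -- half-edges with the same direction overlap near their common vertex
    have hdir : ∀ h : G.edgeSet × Bool, (if h.2 then
        toComplex (D.node h.1 (D.len h.1 - 1)) - toComplex (D.node h.1 (D.len h.1)) else
        toComplex (D.node h.1 1) - toComplex (D.node h.1 0)) ≠ 0 := by
      intro h
      have hpos := D.len_pos h.1 h.1.2
      split_ifs
      · have h1 := D.node_ne_node_succ h.1.2 (k := D.len h.1 - 1) (by omega)
        rw [Nat.sub_add_cancel hpos] at h1
        exact sub_ne_zero.2 fun e => h1 (toComplex.injective e)
      · exact sub_ne_zero.2 fun e => D.node_ne_node_succ h.1.2 hpos (toComplex.injective e.symm)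
    have e1 := fun s : ℝ => D.toComplex_polyline_eq vert h0 h1 h (s := s)
    have e2 := fun s : ℝ => D.toComplex_polyline_eq vert h0 h1 h' (s := s)
    rw [Complex.arg_eq_arg_iff (hdir h) (hdir h')] at harg
    set d := (if h.2 then
        toComplex (D.node h.1 (D.len h.1 - 1)) - toComplex (D.node h.1 (D.len h.1)) else
        toComplex (D.node h.1 1) - toComplex (D.node h.1 0)) with hd
    set d' := (if h'.2 then
        toComplex (D.node h'.1 (D.len h'.1 - 1)) - toComplex (D.node h'.1 (D.len h'.1)) else
        toComplex (D.node h'.1 1) - toComplex (D.node h'.1 0)) with hd'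
    obtain ⟨r, hr, hrd⟩ : ∃ r : ℝ, 0 < r ∧ d' = r * d :=
      ⟨‖d'‖ / ‖d‖, div_pos (norm_pos_iff.2 (hdir h')) (norm_pos_iff.2 (hdir h)), by
        push_cast; exact harg.symm⟩
    obtain ⟨s, s', hs, hs', hss, hrs⟩ : ∃ s s' : ℝ, 0 < s ∧ 0 < s' ∧ s + s' < 1 ∧ s = r * s' := by
      refine ⟨r * (1 / (2 * (1 + r))), 1 / (2 * (1 + r)), by positivity, by positivity, ?_, rfl⟩
      have : r * (1 / (2 * (1 + r))) + 1 / (2 * (1 + r)) = 1 / 2 := by field_simp; ring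
      rw [this]; norm_num
    have e1 := e1 s ⟨hs.le, by linarith⟩
    have e2 := e2 s' ⟨hs'.le, by linarith⟩
    have e3 := e1.trans (Eq.trans (by
      rw [hv, hrd, hrs]; push_cast; ring) e2.symm)
    have e3 := toComplex.injective e3
    have hl : ∀ h : G.edgeSet × Bool, (1 : ℝ) ≤ D.len h.1 := fun h => by
      exact_mod_cast D.len_pos h.1 h.1.2
    have hin : ∀ (h : G.edgeSet × Bool) (s : ℝ), 0 < s → s < 1 →
        (if h.2 then D.len h.1 - s else s) ∈ Set.Ioo (0 : ℝ) (D.len h.1) := by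
      intro h s hs hs1
      have := hl h
      split_ifs <;> constructor <;> linarith
    have m1 := hin h s hs (by linarith)
    have m2 := hin h' s' hs' (by linarith)
    obtain ⟨e, b⟩ := h
    obtain ⟨f, b'⟩ := h'
    by_cases hef : e = f
    · subst hef
      have := D.edge_injOn e e.2 m1 m2 e3
      have hl : (1 : ℝ) ≤ D.len e := hl (e, b)
      cases b <;> cases b' <;> simp at this hne <;> linarith
    · exact D.edge_ne_edge e e.2 f f.2 (fun h => hef (Subtype.ext h)) _ m1 _ m2 e3

end Net

end PlaneDrawing

end Graph

namespace FourValentMap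

open Finset

/-! ### The four-valent map of a plane drawing -/

namespace PolygonalNet

variable {V Ed : Type*} (N : PolygonalNet V Ed) [Fintype V] [DecidableEq V] [Fintype Ed]

omit [Fintype V] in
/-- In a plane drawing with four half-edges at every vertex, the half-edges at a vertex can be
numbered `0, 1, 2, 3` by increasing argument. -/
lemma exists_ranking [DecidableEq Ed] (hdeg : ∀ x, #{h | N.vert h = x} = 4) :
    ∃ Φ : V × Fin 4 ≃ Ed × Bool, (∀ p, N.vert (Φ p) = p.1) ∧
      ∀ x r s, N.angle (Φ (x, r)) < N.angle (Φ (x, s)) ↔ r < s := by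
  have h1 : ∀ x, ∃ f : Fin 4 → Ed × Bool, (∀ r s, N.angle (f r) < N.angle (f s) ↔ r < s) ∧
      (∀ r, N.vert (f r) = x) ∧ ∀ h, N.vert h = x → ∃ r, f r = h := by
    intro x
    have hinj : Set.InjOn N.angle
        (({h | N.vert h = x} : Finset (Ed × Bool)) : Set (Ed × Bool)) := by
      intro h hh h' hh' e
      by_contra hne
      simp only [Finset.coe_filter, Finset.mem_univ, true_and] at hh hh'
      exact N.angle_ne hne (Eq.trans hh (Eq.symm hh')) e
    have hcard : (({h | N.vert h = x} : Finset (Ed × Bool)).image N.angle).card = 4 := by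
      rw [Finset.card_image_of_injOn hinj, hdeg x]
    set o := (({h | N.vert h = x} : Finset (Ed × Bool)).image N.angle).orderIsoOfFin hcard
    have h2 : ∀ r, ∃ h, N.vert h = x ∧ N.angle h = o r := by
      intro r
      have := (o r).2
      rw [Finset.mem_image] at this
      simpa using this
    choose f hf1 hf2 using h2
    refine ⟨f, fun r s => ?_, hf1, fun h hh => ?_⟩
    · rw [hf2, hf2, Subtype.coe_lt_coe, o.lt_iff_lt]
    · have hm : N.angle h ∈ ({h | N.vert h = x} : Finset (Ed × Bool)).image N.angle :=
        Finset.mem_image_of_mem _ (by simpa using hh)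
      refine ⟨o.symm ⟨_, hm⟩, ?_⟩
      refine hinj (by simpa using hf1 _) (by simpa using hh) ?_
      rw [hf2, OrderIso.apply_symm_apply]
  choose f hf1 hf2 hf3 using h1
  have hinj : ∀ x, Function.Injective (f x) := by
    intro x r s e
    by_contra hne
    rcases lt_or_gt_of_ne hne with h | h
    · have := (hf1 x r s).2 h; rw [e] at this; exact lt_irrefl _ this
    · have := (hf1 x s r).2 h; rw [e] at this; exact lt_irrefl _ this
  refine ⟨Equiv.ofBijective (fun p => f p.1 p.2) ⟨?_, ?_⟩, fun p => hf2 _ _, fun x => hf1 x⟩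
  · rintro ⟨x, r⟩ ⟨y, s⟩ e
    obtain rfl : x = y := by rw [← hf2 x r, ← hf2 y s]; exact congrArg N.vert e
    exact Prod.ext rfl (hinj x e)
  · intro h
    obtain ⟨r, hr⟩ := hf3 _ h rfl
    exact ⟨(N.vert h, r), hr⟩

/-- The other half of an edge. -/
def otherHalf (h : Ed × Bool) : Ed × Bool := (h.1, !h.2)

omit [Fintype Ed] in
@[simp] lemma otherHalf_otherHalf (h : Ed × Bool) : otherHalf (otherHalf h) = h := by
  simp [otherHalf]

omit [Fintype Ed] in
lemma otherHalf_ne (h : Ed × Bool) : otherHalf h ≠ h := fun e => by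
  have := congrArg Prod.snd e
  simp [otherHalf] at this

/-- The four-valent map of a plane drawing is planar. -/
lemma isPlanarMap {Φ : V × Fin 4 ≃ Ed × Bool} (hΦ : ∀ p, N.vert (Φ p) = p.1)
    (hΦ' : ∀ x r s, N.angle (Φ (x, r)) < N.angle (Φ (x, s)) ↔ r < s) :
    IsPlanarMap fun p => Φ.symm (otherHalf (Φ p)) := by
  intro c c' hc hc' hcc'
  have hcyc : ∀ c : V × Fin 4 → ℤ, FourValentMap.IsCycle (fun p => Φ.symm (otherHalf (Φ p))) c →
      N.IsCycle fun h => c (Φ.symm h) := by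
    intro c hc
    refine ⟨fun f => ?_, fun x => ?_⟩
    · have := hc.1 (Φ.symm (f, false))
      simpa [otherHalf] using this
    · refine Eq.trans ?_ (hc.2 x)
      rw [← Φ.sum_comp, Fintype.sum_prod_type, Finset.sum_eq_single x]
      · simp [hΦ]
      · intro y _ hy; simp [hΦ, hy]
      · simp
  have h := intersection_eq_zero (hcyc c hc) (hcyc c' hc') (fun f => hcc' _)
  refine Eq.trans ?_ h
  rw [← Φ.sum_comp, Fintype.sum_prod_type]
  refine Finset.sum_congr rfl fun x _ => ?_
  rw [Finset.sum_comm]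
  refine Finset.sum_congr rfl fun s _ => ?_
  rw [← Φ.sum_comp, Fintype.sum_prod_type, Finset.sum_eq_single x]
  · refine Finset.sum_congr rfl fun r _ => ?_
    simp only [hΦ, hΦ', Equiv.symm_apply_apply, if_true, rankSign]
    rcases lt_trichotomy r s with hrs | rfl | hrs
    · simp [hrs]
    · rcases hcc' (x, r) with h0 | h0 <;> simp [h0]
    · simp [hrs, hrs.not_gt]
  · intro y _ hy
    simp [hΦ, hy]
  · simp

end PolygonalNet

end FourValentMap

namespace Graph

open Finset

open FourValentMap FourValentMap.PolygonalNet

variable {α β : Type*} {G : Graph α β}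

/-- A connected plane four-valent graph has a convenient Euler cycle. -/
theorem IsPlanar.exists_isConvenient (hV : G.vertexSet.Finite) (hE : G.edgeSet.Finite)
    (hconn : G.IsConnected) (hdeg : ∀ x ∈ G.vertexSet, G.degree x = 4) (hG : G.IsPlanar) :
    ∃ T : G.EulerCycle, T.IsConvenient := by
  classical
  obtain ⟨D⟩ := hG
  have := hV.fintype
  have := hE.fintype
  have : Nonempty α := ⟨hconn.1.some⟩
  choose! src tgt hlink h0 h1 using D.joins
  set vert : G.edgeSet × Bool → G.vertexSet := fun h =>
    if h.2 then ⟨tgt h.1, (hlink h.1 h.1.2).right_mem⟩ else ⟨src h.1, (hlink h.1 h.1.2).left_mem⟩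
    with hvert
  have hvf : ∀ e, (vert (e, false) : α) = src e := fun e => rfl
  have hvt : ∀ e, (vert (e, true) : α) = tgt e := fun e => rfl
  set N := D.toNet vert (fun e => h0 e e.2) (fun e => h1 e e.2) with hN
  have hNv : ∀ h, N.vert h = vert h := fun _ => rfl
  have hflip : ∀ h : G.edgeSet × Bool, G.IsLink h.1 (vert h) (vert (otherHalf h)) := by
    rintro ⟨e, b⟩
    cases b
    · exact hlink e e.2
    · exact (hlink e e.2).symm
  have hcard : ∀ x, #{h | N.vert h = x} = 4 := by
    intro x
    rw [← hdeg x x.2, degree_eq_ncard_add_ncard hE hlink x]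
    have e1 : ∀ f : β → α, {e ∈ G.edgeSet | f e = x}.ncard =
        #{e : G.edgeSet | f e = x} := by
      intro f
      rw [← Set.ncard_coe_finset, ← Set.ncard_image_of_injective _ Subtype.val_injective]
      congr 1
      ext e
      simp [and_comm]
    rw [e1, e1, Finset.card_filter, Finset.card_filter, Finset.card_filter,
      Fintype.sum_prod_type, ← Finset.sum_add_distrib]
    refine Finset.sum_congr rfl fun e _ => ?_
    rw [Fintype.sum_bool, add_comm]
    simp only [hNv, Subtype.ext_iff, hvf, hvt]
  obtain ⟨Φ, hΦ, hΦ'⟩ := N.exists_ranking hcard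
  obtain ⟨ε, hεd, hK⟩ : ∃ ε : G.vertexSet × Fin 4 → G.vertexSet × Fin 4,
      (∀ p, ε p = Φ.symm (otherHalf (Φ p))) ∧ IsPlanarMap ε :=
    ⟨_, fun _ => rfl, N.isPlanarMap hΦ hΦ'⟩
  have hε : ∀ p, ε (ε p) = p := fun p => by simp [hεd]
  have hε' : ∀ p, ε p ≠ p := fun p e => by
    rw [hεd, Equiv.symm_apply_eq] at e
    exact otherHalf_ne _ e
  have hεv : ∀ p, ((ε p).1 : α) = vert (otherHalf (Φ p)) := fun p => by
    rw [← hΦ, hεd, Equiv.apply_symm_apply, hNv]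
  have hne : Nonempty G.vertexSet := hconn.1.to_subtype
  have hcon : ∀ S : Set (G.vertexSet × Fin 4), S.Nonempty → (∀ p ∈ S, ε p ∈ S) →
      (∀ x r s, (x, r) ∈ S → (x, s) ∈ S) → S = Set.univ := by
    rintro S ⟨⟨x, r⟩, hp⟩ hSε hS
    have key : ∀ y, Relation.ReflTransGen G.Adj x y → ∀ hy : y ∈ G.vertexSet, ∀ r,
        ((⟨y, hy⟩, r) : G.vertexSet × Fin 4) ∈ S := by
      intro y hxy
      induction hxy with
      | refl => exact fun _ s => hS x r s hp
      | @tail y z _ hyz ih =>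
        intro hz s
        obtain ⟨e, he⟩ := hyz
        obtain ⟨b, hb, hb'⟩ : ∃ b, (vert (⟨e, he.edge_mem⟩, b) : α) = y ∧
            (vert (otherHalf (⟨e, he.edge_mem⟩, b)) : α) = z := by
          rcases (hlink e he.edge_mem).eq_and_eq_or_eq_and_eq he with h | h
          · exact ⟨false, h⟩
          · exact ⟨true, h.symm⟩
        set p := Φ.symm (⟨e, he.edge_mem⟩, b) with hpd
        have hp1 : p.1 = ⟨y, he.left_mem⟩ := by
          rw [← hΦ, hpd, Equiv.apply_symm_apply]; exact Subtype.ext hb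
        have hp2 : (ε p).1 = ⟨z, hz⟩ := by
          apply Subtype.ext
          rw [hεv, hpd, Equiv.apply_symm_apply, hb']
        have hpS : p ∈ S := by
          have := ih he.left_mem p.2
          rwa [← hp1] at this
        have := hS _ _ s (hSε p hpS : ((ε p).1, (ε p).2) ∈ S)
        rwa [hp2] at this
    rw [Set.eq_univ_iff_forall]
    rintro ⟨y, s⟩
    exact key y (hconn.2 x x.2 y y.2) y.2 s
  obtain ⟨T⟩ := exists_tour hε hε' hcon
  obtain ⟨A, hA⟩ := T.exists_sides hε hε' hK
  have hedge : ∀ p q, (Φ p).1 = (Φ q).1 → p = q ∨ p = ε q := by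
    intro p q h
    by_cases hb : (Φ p).2 = (Φ q).2
    · exact Or.inl (Φ.injective (Prod.ext h hb))
    · refine Or.inr ?_
      rw [hεd, Equiv.eq_symm_apply]
      exact Prod.ext h (by rw [otherHalf]; exact Bool.eq_not.2 hb)
  let C : G.EulerCycle :=
    { len := T.len
      vert := fun t => T.vert t
      edge := fun t => (Φ (T.out t)).1
      len_pos := T.len_pos
      closed := by simp [Tour.vert, T.closed]
      isLink := by
        intro t _
        have := hflip (Φ (T.out t))
        rw [← hεv, T.edge_out, ← hNv, hΦ] at this
        exact this
      edge_bijOn := by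
        refine ⟨fun t _ => (Φ (T.out t)).1.2, fun t ht s hs h => ?_, fun e he => ?_⟩
        · exact T.unique t ht s hs (hedge _ _ (Subtype.ext h))
        · obtain ⟨t, ht, h⟩ := T.exists_eq (Φ.symm (⟨e, he⟩, false))
          refine ⟨t, ht, ?_⟩
          rcases h with h | h
          · simp [← h]
          · rw [hεd, Equiv.symm_apply_eq, Equiv.apply_symm_apply] at h
            exact (congrArg (fun h => (h.1 : β)) h).symm }
  refine ⟨C, Subtype.val '' A, Subtype.val '' Aᶜ, ?_, ?_, ?_⟩
  · rw [← Set.image_union, Set.union_compl_self, Set.image_univ, Subtype.range_coe]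
  · exact (Set.disjoint_image_iff Subtype.val_injective).2 disjoint_compl_right
  · have key : ∀ P Q : G.vertexSet, C.Interlaced P Q → (P ∈ A ↔ Q ∉ A) := by
      rintro P Q ⟨hne, i, j, k, l, hij, hjk, hkl, hl, h⟩
      rcases h with ⟨hi, hj, hk, hl'⟩ | ⟨hi, hj, hk, hl'⟩ <;>
        replace hi := Subtype.ext hi <;> replace hj := Subtype.ext hj <;>
        replace hk := Subtype.ext hk <;> replace hl' := Subtype.ext hl' <;>
        have := hA i j k l hij hjk hkl hl (hi.trans hk.symm) (hj.trans hl'.symm)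
      · subst hi hj
        exact this fun e => hne (congrArg _ e)
      · subst hi hj
        have := this fun e => hne (congrArg _ e.symm)
        tauto
    constructor
    · rintro _ ⟨P, hP, rfl⟩ _ ⟨Q, hQ, rfl⟩ h
      exact (key P Q h).1 hP hQ
    · rintro _ ⟨P, hP, rfl⟩ _ ⟨Q, hQ, rfl⟩ h
      exact hP ((key P Q h).2 hQ)

/-! ### A plane drawing of a chord diagram -/

/-- A cyclic sequence of `len` visits in which every element is visited twice, at `lo` and at `hi`,
together with a choice of sides such that chords on the same side do not cross. -/
structure ChordDiagram (α : Type*) where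
  /-- The number of visits. -/
  len : ℕ
  /-- The element visited at a time `t < len`. -/
  vert : ℕ → α
  /-- The first visit of an element. -/
  lo : α → ℕ
  /-- The second visit of an element. -/
  hi : α → ℕ
  /-- The side of the chord from `lo` to `hi`: `1` is above, `-1` is below. -/
  side : α → ℝ
  side_eq : ∀ x, side x = 1 ∨ side x = -1
  eq_lo_or_eq_hi : ∀ t < len, t = lo (vert t) ∨ t = hi (vert t)
  lo_lt_hi : ∀ t < len, lo (vert t) < hi (vert t)
  hi_lt : ∀ t < len, hi (vert t) < len
  noncrossing : ∀ s < len, ∀ t < len, vert s ≠ vert t → side (vert s) = side (vert t) →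
    hi (vert s) < lo (vert t) ∨ hi (vert t) < lo (vert s) ∨
    (lo (vert s) < lo (vert t) ∧ hi (vert t) < hi (vert s)) ∨
    (lo (vert t) < lo (vert s) ∧ hi (vert s) < hi (vert t))

namespace ChordDiagram

variable {α : Type*} (C : ChordDiagram α)

/-- The point of the plane that represents an element: the apex of an isosceles right triangle
whose hypotenuse lies on the horizontal axis and reaches from `4 lo - 1` to `4 hi + 1`. -/
noncomputable def apex (x : α) : EuclideanSpace ℝ (Fin 2) :=
  !₂[2 * ((C.lo x : ℝ) + C.hi x), C.side x * (2 * ((C.hi x : ℝ) - C.lo x) + 1)]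

/-- The segment from the point `4 t + δ` of the horizontal axis to the apex of the element visited
at the time `t`. For `δ = -1` it carries the edge that arrives, for `δ = 1` the one that leaves. -/
noncomputable def leg (t : ℕ) (δ τ : ℝ) : EuclideanSpace ℝ (Fin 2) :=
  !₂[(1 - τ) * (4 * t + δ) + τ * (2 * ((C.lo (C.vert t) : ℝ) + C.hi (C.vert t))),
    C.side (C.vert t) * (τ * (2 * ((C.hi (C.vert t) : ℝ) - C.lo (C.vert t)) + 1))]

/-- The next visit in the cyclic order. -/
def next (t : ℕ) : ℕ := if t + 1 < C.len then t + 1 else 0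

/-- The point halfway between the visit `t` and the next one. It lies on the horizontal axis, except
that the way from the last visit to the first one leads high above everything else. -/
noncomputable def mid (t : ℕ) : EuclideanSpace ℝ (Fin 2) :=
  if t + 1 < C.len then !₂[4 * (t : ℝ) + 2, 0] else !₂[2 * (C.len : ℝ) - 2, 2 * (C.len : ℝ)]

/-- The break points of the edge from the visit `t` to the next one. -/
noncomputable def node (t : ℕ) : ℕ → EuclideanSpace ℝ (Fin 2)
  | 0 => C.apex (C.vert t)
  | 1 => !₂[4 * (t : ℝ) + 1, 0]
  | 2 => C.mid t
  | 3 => !₂[4 * (C.next t : ℝ) - 1, 0]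
  | _ => C.apex (C.vert (C.next t))

lemma next_lt {t : ℕ} (ht : t < C.len) : C.next t < C.len := by
  unfold next; split_ifs <;> omega

lemma next_injective {s t : ℕ} (hs : s < C.len) (ht : t < C.len) (h : C.next s = C.next t) :
    s = t := by
  unfold next at h; split_ifs at h <;> omega

lemma leg_one (t : ℕ) (δ : ℝ) : C.leg t δ 1 = C.apex (C.vert t) := by
  simp [leg, apex]

/-- The whole star of legs of an element lies in its triangle; the legs on the left lie on the left
of the inner region that is left free for nested triangles, those on the right on its right. -/
lemma leg_bounds {t : ℕ} (ht : t < C.len) {δ τ : ℝ} (hδ : δ = 1 ∨ δ = -1)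
    (hτ : τ ∈ Set.Icc (0 : ℝ) 1) :
    ∃ y, 0 ≤ y ∧ C.leg t δ τ 1 = C.side (C.vert t) * y ∧
      4 * (C.lo (C.vert t) : ℝ) - 1 ≤ C.leg t δ τ 0 - y ∧
      C.leg t δ τ 0 + y ≤ 4 * (C.hi (C.vert t) : ℝ) + 1 ∧
      (C.leg t δ τ 0 - y ≤ 4 * (C.lo (C.vert t) : ℝ) + 1 ∨
        4 * (C.hi (C.vert t) : ℝ) - 1 ≤ C.leg t δ τ 0 + y) := by
  have h1 := C.lo_lt_hi t ht
  have h2 : (C.lo (C.vert t) : ℝ) + 1 ≤ C.hi (C.vert t) := by exact_mod_cast h1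
  have h3 : ((t : ℝ) = C.lo (C.vert t)) ∨ (t : ℝ) = C.hi (C.vert t) := by
    exact_mod_cast C.eq_lo_or_eq_hi t ht
  obtain ⟨hτ0, hτ1⟩ := hτ
  refine ⟨τ * (2 * ((C.hi (C.vert t) : ℝ) - C.lo (C.vert t)) + 1),
    mul_nonneg hτ0 (by linarith), by simp [leg], ?_⟩
  simp only [leg, PiLp.toLp_apply, Matrix.cons_val_zero]
  generalize (C.lo (C.vert t) : ℝ) = a at *
  generalize (C.hi (C.vert t) : ℝ) = b at *
  rcases h3 with h3 | h3 <;> rw [h3] <;> rcases hδ with rfl | rfl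
  · refine ⟨by nlinarith, by nlinarith, Or.inl (by nlinarith)⟩
  · refine ⟨by nlinarith, by nlinarith, Or.inl (by nlinarith)⟩
  · refine ⟨by nlinarith, by nlinarith, Or.inr (by nlinarith)⟩
  · refine ⟨by nlinarith, by nlinarith, Or.inr (by nlinarith)⟩

lemma eq_of_four_mul_add_eq {s t : ℕ} {δ δ' : ℝ} (hδ : δ = 1 ∨ δ = -1) (hδ' : δ' = 1 ∨ δ' = -1)
    (h : 4 * (s : ℝ) + δ = 4 * t + δ') : s = t ∧ δ = δ' := by
  rcases hδ with rfl | rfl <;> rcases hδ' with rfl | rfl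
  · exact ⟨by exact_mod_cast (by linarith : (s : ℝ) = t), rfl⟩
  · have : (4 * s + 2 : ℝ) = 4 * t := by linarith
    have : 4 * s + 2 = 4 * t := by exact_mod_cast this
    omega
  · have : (4 * t + 2 : ℝ) = 4 * s := by linarith
    have : 4 * t + 2 = 4 * s := by exact_mod_cast this
    omega
  · exact ⟨by exact_mod_cast (by linarith : (s : ℝ) = t), rfl⟩

/-- Two legs do not meet, except at a common apex. -/
lemma leg_inj {s t : ℕ} (hs : s < C.len) (ht : t < C.len) {δ δ' τ τ' : ℝ}
    (hδ : δ = 1 ∨ δ = -1) (hδ' : δ' = 1 ∨ δ' = -1) (hτ : τ ∈ Set.Icc (0 : ℝ) 1)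
    (hτ' : τ' ∈ Set.Icc (0 : ℝ) 1) (h : C.leg s δ τ = C.leg t δ' τ') :
    C.vert s = C.vert t ∧ τ = τ' ∧ (τ < 1 → s = t ∧ δ = δ') := by
  have e0 : C.leg s δ τ 0 = C.leg t δ' τ' 0 := by rw [h]
  have e1 : C.leg s δ τ 1 = C.leg t δ' τ' 1 := by rw [h]
  by_cases hv : C.vert s = C.vert t
  · -- on the legs of one element the height determines the parameter
    refine ⟨hv, ?_⟩
    have h2 : (C.lo (C.vert t) : ℝ) + 1 ≤ C.hi (C.vert t) := by exact_mod_cast C.lo_lt_hi t ht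
    have hside : C.side (C.vert t) ≠ 0 := by
      rcases C.side_eq (C.vert t) with h | h <;> rw [h] <;> norm_num
    simp only [leg, PiLp.toLp_apply, Matrix.cons_val_zero, Matrix.cons_val_one, hv] at e0 e1
    have hττ : τ = τ' := by
      have := mul_left_cancel₀ hside e1
      exact mul_right_cancel₀ (by linarith) this
    subst hττ
    refine ⟨rfl, fun h1 => eq_of_four_mul_add_eq hδ hδ' ?_⟩
    exact mul_left_cancel₀ (sub_ne_zero.2 h1.ne') (add_right_cancel e0)
  · exfalso
    obtain ⟨y, hy, hye, hya, hyd, hyn⟩ := C.leg_bounds hs hδ hτ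
    obtain ⟨y', hy', hye', hya', hyd', hyn'⟩ := C.leg_bounds ht hδ' hτ'
    rw [hye, hye'] at e1
    rw [e0] at hya hyd hyn
    generalize C.leg t δ' τ' 0 = X at *
    by_cases hside : C.side (C.vert s) = C.side (C.vert t)
    · have hyy : y = y' := by
        rw [hside] at e1
        refine mul_left_cancel₀ ?_ e1
        rcases C.side_eq (C.vert t) with h | h <;> rw [h] <;> norm_num
      subst hyy
      have cast : ∀ {a b : ℕ}, a < b → (a : ℝ) + 1 ≤ b := fun h => by exact_mod_cast h
      rcases C.noncrossing s hs t ht hv hside with h | h | ⟨h, h'⟩ | ⟨h, h'⟩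
      · linarith [cast h]
      · linarith [cast h]
      · rcases hyn with h'' | h'' <;> linarith [cast h, cast h']
      · rcases hyn' with h'' | h'' <;> linarith [cast h, cast h']
    · -- legs on different sides could only meet on the axis, at their feet
      have hyy : y = 0 ∧ y' = 0 := by
        rcases C.side_eq (C.vert s) with h1 | h1 <;> rcases C.side_eq (C.vert t) with h2 | h2 <;>
          rw [h1, h2] at e1 hside
        · exact absurd rfl hside
        · constructor <;> linarith
        · constructor <;> linarith
        · exact absurd rfl hside
      have foot : ∀ {r : ℕ}, r < C.len → ∀ {δ τ : ℝ}, C.leg r δ τ 1 = C.side (C.vert r) * 0 →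
          τ = 0 := by
        intro r hr δ τ h
        have h2 : (C.lo (C.vert r) : ℝ) + 1 ≤ C.hi (C.vert r) := by exact_mod_cast C.lo_lt_hi r hr
        have hside : C.side (C.vert r) ≠ 0 := by
          rcases C.side_eq (C.vert r) with h | h <;> rw [h] <;> norm_num
        simp only [leg, PiLp.toLp_apply, Matrix.cons_val_one] at h
        rcases mul_eq_zero.1 (mul_left_cancel₀ hside h) with h | h
        · exact h
        · linarith
      obtain rfl : τ = 0 := foot hs (by rw [hye, hyy.1])
      obtain rfl : τ' = 0 := foot ht (by rw [hye', hyy.2])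
      have e0 : C.leg s δ 0 0 = C.leg t δ' 0 0 := by rw [h]
      simp only [leg, PiLp.toLp_apply, Matrix.cons_val_zero] at e0
      have hst := (eq_of_four_mul_add_eq (s := s) (t := t) hδ hδ' (by linarith)).1
      exact hv (by rw [hst])

/-- The middle part of an edge, between its two legs. -/
noncomputable def bridge (t : ℕ) (τ : ℝ) : EuclideanSpace ℝ (Fin 2) :=
  if t + 1 < C.len then !₂[4 * (t : ℝ) + 1 + τ, 0] else
    if τ ≤ 1 then !₂[4 * (C.len : ℝ) - 3 - τ * (2 * C.len - 1), τ * (2 * C.len)] else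
      !₂[2 * (C.len : ℝ) - 2 - (τ - 1) * (2 * C.len - 1), (2 - τ) * (2 * C.len)]

lemma bridge_cases {t : ℕ} (ht : t < C.len) (τ : ℝ) :
    (t + 1 < C.len ∧ C.bridge t τ 0 = 4 * (t : ℝ) + 1 + τ ∧ C.bridge t τ 1 = 0) ∨
    (t + 1 = C.len ∧ τ ≤ 1 ∧ C.bridge t τ 0 = 4 * (C.len : ℝ) - 3 - τ * (2 * C.len - 1) ∧
      C.bridge t τ 1 = τ * (2 * C.len)) ∨
    (t + 1 = C.len ∧ 1 < τ ∧ C.bridge t τ 0 = 2 * (C.len : ℝ) - 2 - (τ - 1) * (2 * C.len - 1) ∧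
      C.bridge t τ 1 = (2 - τ) * (2 * C.len)) := by
  unfold bridge
  split_ifs with h1 h2
  · exact Or.inl ⟨h1, by simp, by simp⟩
  · exact Or.inr (Or.inl ⟨by omega, h2, by simp, by simp⟩)
  · exact Or.inr (Or.inr ⟨by omega, not_le.1 h2, by simp, by simp⟩)

lemma bridge_ne_leg {s t : ℕ} (hs : s < C.len) (ht : t < C.len) {τ δ τ' : ℝ}
    (hτ : τ ∈ Set.Ioo (0 : ℝ) 2) (hδ : δ = 1 ∨ δ = -1) (hτ' : τ' ∈ Set.Icc (0 : ℝ) 1) :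
    C.bridge s τ ≠ C.leg t δ τ' := by
  intro h
  have e0 : C.bridge s τ 0 = C.leg t δ τ' 0 := by rw [h]
  have e1 : C.bridge s τ 1 = C.leg t δ τ' 1 := by rw [h]
  have hm : (1 : ℝ) ≤ C.len := by exact_mod_cast (by omega : 1 ≤ C.len)
  obtain ⟨y, hy, hye, hya, hyd, -⟩ := C.leg_bounds ht hδ hτ'
  have hlo : (0 : ℝ) ≤ C.lo (C.vert t) := Nat.cast_nonneg _
  have hhi : (C.hi (C.vert t) : ℝ) + 1 ≤ C.len := by exact_mod_cast C.hi_lt t ht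
  obtain ⟨hb1, hb2⟩ : -1 ≤ C.leg t δ τ' 0 - C.leg t δ τ' 1 ∧
      C.leg t δ τ' 0 + C.leg t δ τ' 1 ≤ 4 * C.len - 3 := by
    rcases C.side_eq (C.vert t) with h1 | h1 <;> rw [hye, h1] <;> constructor <;> linarith
  rw [← e0, ← e1] at hb1 hb2
  rcases C.bridge_cases hs τ with ⟨-, c0, c1⟩ | ⟨-, h1, c0, c1⟩ | ⟨-, h1, c0, c1⟩
  · have h2 : (C.lo (C.vert t) : ℝ) + 1 ≤ C.hi (C.vert t) := by exact_mod_cast C.lo_lt_hi t ht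
    have hside : C.side (C.vert t) ≠ 0 := by
      rcases C.side_eq (C.vert t) with h | h <;> rw [h] <;> norm_num
    rw [c1] at e1
    rw [c0] at e0
    simp only [leg, PiLp.toLp_apply, Matrix.cons_val_zero, Matrix.cons_val_one] at e0 e1
    have hτ0 : τ' = 0 := by
      rcases mul_eq_zero.1 ((mul_eq_zero.1 e1.symm).resolve_left hside) with h | h
      · exact h
      · linarith
    rw [hτ0] at e0
    have h3 : 4 * (s : ℝ) + 1 < 4 * t + δ := by linarith [hτ.1]
    have h4 : 4 * (t : ℝ) + δ < 4 * s + 3 := by linarith [hτ.2]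
    rcases hδ with rfl | rfl
    · have h3 : 4 * s + 1 < 4 * t + 1 := by exact_mod_cast h3
      have h4 : 4 * t + 1 < 4 * s + 3 := by exact_mod_cast h4
      omega
    · have h3 : 4 * s + 1 + 1 < 4 * t := by
        exact_mod_cast (by linarith : 4 * (s : ℝ) + 1 + 1 < 4 * t)
      have h4 : 4 * t < 4 * s + 4 := by
        exact_mod_cast (by linarith : 4 * (t : ℝ) < 4 * s + 4)
      omega
  · rw [c0, c1] at hb2
    linarith [hτ.1]
  · rw [c0, c1] at hb1
    linarith [hτ.2]

lemma bridge_inj {s t : ℕ} (hs : s < C.len) (ht : t < C.len) {τ τ' : ℝ}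
    (hτ : τ ∈ Set.Ioo (0 : ℝ) 2) (hτ' : τ' ∈ Set.Ioo (0 : ℝ) 2)
    (h : C.bridge s τ = C.bridge t τ') : s = t ∧ τ = τ' := by
  have e0 : C.bridge s τ 0 = C.bridge t τ' 0 := by rw [h]
  have e1 : C.bridge s τ 1 = C.bridge t τ' 1 := by rw [h]
  have hm : (1 : ℝ) ≤ C.len := by exact_mod_cast (by omega : 1 ≤ C.len)
  obtain ⟨hτ0, hτ2⟩ := hτ
  obtain ⟨hτ0', hτ2'⟩ := hτ'
  rcases C.bridge_cases hs τ with ⟨hst, c0, c1⟩ | ⟨hst, h1, c0, c1⟩ | ⟨hst, h1, c0, c1⟩ <;>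
    rcases C.bridge_cases ht τ' with
      ⟨htt, c0', c1'⟩ | ⟨htt, h1', c0', c1'⟩ | ⟨htt, h1', c0', c1'⟩ <;>
    rw [c0, c0'] at e0 <;> rw [c1, c1'] at e1
  · have h3 : 4 * s < 4 * t + 2 := by
      exact_mod_cast (by linarith : 4 * (s : ℝ) < 4 * t + 2)
    have h4 : 4 * t < 4 * s + 2 := by
      exact_mod_cast (by linarith : 4 * (t : ℝ) < 4 * s + 2)
    obtain rfl : s = t := by omega
    exact ⟨rfl, by linarith⟩
  · have : 0 < τ' * (2 * (C.len : ℝ)) := by positivity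
    linarith
  · have : 0 < (2 - τ') * (2 * (C.len : ℝ)) := mul_pos (by linarith) (by linarith)
    linarith
  · have : 0 < τ * (2 * (C.len : ℝ)) := by positivity
    linarith
  · exact ⟨by omega, mul_right_cancel₀ (by linarith) e1⟩
  · nlinarith
  · have : 0 < (2 - τ) * (2 * (C.len : ℝ)) := mul_pos (by linarith) (by linarith)
    linarith
  · nlinarith
  · refine ⟨by omega, ?_⟩
    have : 2 - τ = 2 - τ' := mul_right_cancel₀ (by linarith) e1
    linarith

/-- The points of an edge. -/
lemma polyline_node {t : ℕ} (ht : t < C.len) {u : ℝ} (hu : u ∈ Set.Ioo (0 : ℝ) 4) :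
    (u ≤ 1 ∧ polyline (C.node t) u = C.leg t 1 (1 - u)) ∨
    (u ∈ Set.Ioo (1 : ℝ) 3 ∧ polyline (C.node t) u = C.bridge t (u - 1)) ∨
    (3 ≤ u ∧ polyline (C.node t) u = C.leg (C.next t) (-1) (u - 3)) := by
  rcases le_or_gt u 1 with h1 | h1
  · left
    refine ⟨h1, ?_⟩
    have := polyline_add (C.node t) 0 (t := u) ⟨hu.1.le, h1⟩
    simp only [Nat.cast_zero, zero_add] at this
    rw [this]
    ext i
    fin_cases i <;> simp [node, leg, apex, AffineMap.lineMap_apply_module'] <;> ring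
  rcases le_or_gt 3 u with h3 | h3
  · right; right
    refine ⟨h3, ?_⟩
    have := polyline_add (C.node t) 3 (t := u - 3) ⟨by linarith, by linarith [hu.2]⟩
    rw [show ((3 : ℕ) : ℝ) + (u - 3) = u by push_cast; ring] at this
    rw [this]
    ext i
    fin_cases i <;> simp [node, leg, apex, AffineMap.lineMap_apply_module'] <;> ring
  right; left
  refine ⟨⟨h1, h3⟩, ?_⟩
  have hlast : ¬ t + 1 < C.len → (C.len : ℝ) = t + 1 := fun h => by
    exact_mod_cast (by omega : C.len = t + 1)
  rcases le_or_gt u 2 with h2 | h2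
  · have := polyline_add (C.node t) 1 (t := u - 1) ⟨by linarith, by linarith⟩
    rw [show ((1 : ℕ) : ℝ) + (u - 1) = u by push_cast; ring] at this
    rw [this]
    by_cases hl : t + 1 < C.len
    · ext i
      fin_cases i <;>
        simp [node, mid, bridge, hl, AffineMap.lineMap_apply_module']
      ring
    · have hu1 : u - 1 ≤ 1 := by linarith
      ext i
      fin_cases i <;>
        simp [node, mid, bridge, hl, hu1, AffineMap.lineMap_apply_module', hlast hl]
      ring
  · have := polyline_add (C.node t) 2 (t := u - 2) ⟨by linarith, by linarith⟩
    rw [show ((2 : ℕ) : ℝ) + (u - 2) = u by push_cast; ring] at this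
    rw [this]
    by_cases hl : t + 1 < C.len
    · ext i
      fin_cases i <;>
        simp [node, mid, bridge, next, hl, AffineMap.lineMap_apply_module']
      ring
    · have hu1 : ¬ u - 1 ≤ 1 := by linarith
      ext i
      fin_cases i <;>
        simp [node, mid, bridge, next, hl, hu1, AffineMap.lineMap_apply_module', hlast hl]
      all_goals ring

/-- The edges of the drawing of a chord diagram meet neither themselves nor each other. -/
lemma polyline_node_inj {s t : ℕ} (hs : s < C.len) (ht : t < C.len) {u u' : ℝ}
    (hu : u ∈ Set.Ioo (0 : ℝ) 4) (hu' : u' ∈ Set.Ioo (0 : ℝ) 4)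
    (h : polyline (C.node s) u = polyline (C.node t) u') : s = t ∧ u = u' := by
  have hns := C.next_lt hs
  have hnt := C.next_lt ht
  have p1 : (1 : ℝ) = 1 ∨ (1 : ℝ) = -1 := Or.inl rfl
  have m1 : (-1 : ℝ) = 1 ∨ (-1 : ℝ) = -1 := Or.inr rfl
  rcases C.polyline_node hs hu with ⟨h1, e⟩ | ⟨h1, e⟩ | ⟨h1, e⟩ <;>
    rcases C.polyline_node ht hu' with ⟨h1', e'⟩ | ⟨h1', e'⟩ | ⟨h1', e'⟩ <;> rw [e, e'] at h
  · obtain ⟨-, h2, h3⟩ := C.leg_inj hs ht p1 p1 ⟨by linarith, by linarith [hu.1]⟩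
      ⟨by linarith, by linarith [hu'.1]⟩ h
    exact ⟨(h3 (by linarith [hu.1])).1, by linarith⟩
  · exact absurd h.symm (C.bridge_ne_leg ht hs ⟨by linarith [h1'.1], by linarith [h1'.2]⟩ p1
      ⟨by linarith, by linarith [hu.1]⟩)
  · obtain ⟨-, h2, h3⟩ := C.leg_inj hs hnt p1 m1 ⟨by linarith, by linarith [hu.1]⟩
      ⟨by linarith, by linarith [hu'.2]⟩ h
    have := (h3 (by linarith [hu.1])).2
    norm_num at this
  · exact absurd h (C.bridge_ne_leg hs ht ⟨by linarith [h1.1], by linarith [h1.2]⟩ p1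
      ⟨by linarith, by linarith [hu'.1]⟩)
  · obtain ⟨h2, h3⟩ := C.bridge_inj hs ht ⟨by linarith [h1.1], by linarith [h1.2]⟩
      ⟨by linarith [h1'.1], by linarith [h1'.2]⟩ h
    exact ⟨h2, by linarith⟩
  · exact absurd h (C.bridge_ne_leg hs hnt ⟨by linarith [h1.1], by linarith [h1.2]⟩ m1
      ⟨by linarith, by linarith [hu'.2]⟩)
  · obtain ⟨-, h2, h3⟩ := C.leg_inj hns ht m1 p1 ⟨by linarith, by linarith [hu.2]⟩
      ⟨by linarith, by linarith [hu'.1]⟩ h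
    have := (h3 (by linarith [hu.2])).2
    norm_num at this
  · exact absurd h.symm (C.bridge_ne_leg ht hns ⟨by linarith [h1'.1], by linarith [h1'.2]⟩ m1
      ⟨by linarith, by linarith [hu.2]⟩)
  · obtain ⟨-, h2, h3⟩ := C.leg_inj hns hnt m1 m1 ⟨by linarith, by linarith [hu.2]⟩
      ⟨by linarith, by linarith [hu'.2]⟩ h
    exact ⟨C.next_injective hs ht (h3 (by linarith [hu.2])).1, by linarith⟩

/-- The edges of the drawing of a chord diagram do not pass through its vertices. -/
lemma polyline_node_ne_apex {s t : ℕ} (hs : s < C.len) (ht : t < C.len) {u : ℝ}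
    (hu : u ∈ Set.Ioo (0 : ℝ) 4) : polyline (C.node s) u ≠ C.apex (C.vert t) := by
  rw [← C.leg_one t 1]
  have one : (1 : ℝ) ∈ Set.Icc (0 : ℝ) 1 := by simp
  intro h
  rcases C.polyline_node hs hu with ⟨h1, e⟩ | ⟨h1, e⟩ | ⟨h1, e⟩ <;> rw [e] at h
  · have := (C.leg_inj hs ht (Or.inl rfl) (Or.inl rfl) ⟨by linarith, by linarith [hu.1]⟩ one h).2.1
    linarith [hu.1]
  · exact C.bridge_ne_leg hs ht ⟨by linarith [h1.1], by linarith [h1.2]⟩ (Or.inl rfl) one h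
  · have := (C.leg_inj (C.next_lt hs) ht (Or.inr rfl) (Or.inl rfl)
      ⟨by linarith, by linarith [hu.2]⟩ one h).2.1
    linarith [hu.2]

end ChordDiagram

/-! ### Drawing a graph along a convenient Euler cycle -/

namespace EulerCycle

/-- In a four-valent graph an Euler cycle visits every vertex exactly twice. -/
lemma exists_two_visits (T : G.EulerCycle) (hE : G.edgeSet.Finite) {x : α}
    (hx : G.degree x = 4) : ∃ i k, i < k ∧ k < T.len ∧ T.vert i = x ∧ T.vert k = x ∧
      ∀ t < T.len, T.vert t = x → t = i ∨ t = k := by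
  classical
  have hidx : ∀ e ∈ G.edgeSet, ∃ t, t < T.len ∧ T.edge t = e := fun e he => T.edge_bijOn.2.2 he
  choose! idx hidx1 hidx2 using hidx
  have hidx3 : ∀ t < T.len, idx (T.edge t) = t := fun t ht =>
    T.edge_bijOn.2.1 (hidx1 _ (T.edge_bijOn.1 ht)) ht (hidx2 _ (T.edge_bijOn.1 ht))
  have hcount : ∀ f : ℕ → α, {e ∈ G.edgeSet | f (idx e) = x}.ncard =
      ∑ t ∈ range T.len, if f t = x then 1 else 0 := by
    intro f
    rw [← Finset.card_filter, ← Set.ncard_coe_finset,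
      ← (T.edge_bijOn.2.1.mono (by
        intro t ht
        simp only [Finset.coe_filter, Finset.mem_range] at ht
        exact ht.1)).ncard_image]
    congr 1
    ext e
    simp only [Finset.coe_filter, Finset.mem_range, Set.mem_image, Set.mem_ofPred_eq]
    constructor
    · rintro ⟨he, h⟩
      exact ⟨idx e, ⟨hidx1 e he, h⟩, hidx2 e he⟩
    · rintro ⟨t, ⟨ht, h⟩, rfl⟩
      exact ⟨T.edge_bijOn.1 ht, by rwa [hidx3 t ht]⟩
  have hdeg := degree_eq_ncard_add_ncard hE (src := fun e => T.vert (idx e))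
    (tgt := fun e => T.vert (idx e + 1)) (fun e he => by
      have := T.isLink (idx e) (hidx1 e he)
      rwa [hidx2 e he] at this) x
  rw [hx, hcount T.vert, hcount fun t => T.vert (t + 1)] at hdeg
  have hshift := (Finset.sum_range_succ (fun t => if T.vert t = x then 1 else 0) T.len).symm.trans
    (Finset.sum_range_succ' (fun t => if T.vert t = x then 1 else 0) T.len)
  rw [T.closed] at hshift
  have hcard : #{t ∈ range T.len | T.vert t = x} = 2 := by
    rw [Finset.card_filter]; omega
  obtain ⟨i, k, hik, h⟩ := Finset.card_eq_two.1 hcard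
  have hmem : ∀ t, t < T.len ∧ T.vert t = x ↔ t = i ∨ t = k := by
    intro t
    have : t ∈ ({t ∈ range T.len | T.vert t = x} : Finset ℕ) ↔ t ∈ ({i, k} : Finset ℕ) := by rw [h]
    simpa using this
  have hi := (hmem i).2 (Or.inl rfl)
  have hk := (hmem k).2 (Or.inr rfl)
  rcases lt_or_gt_of_ne hik with hlt | hlt
  · exact ⟨i, k, hlt, hk.1, hi.2, hk.2, fun t ht e => (hmem t).1 ⟨ht, e⟩⟩
  · exact ⟨k, i, hlt, hi.1, hk.2, hi.2, fun t ht e => ((hmem t).1 ⟨ht, e⟩).symm⟩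

/-- A four-valent graph with a convenient Euler cycle is planar. -/
theorem IsConvenient.isPlanar {T : G.EulerCycle} (hT : T.IsConvenient) (hE : G.edgeSet.Finite)
    (hdeg : ∀ x ∈ G.vertexSet, G.degree x = 4) : G.IsPlanar := by
  classical
  obtain ⟨A, B, hAB, -, hA, hB⟩ := hT
  have hvisits := fun x hx => T.exists_two_visits hE (hdeg x hx)
  choose! lo hi hlt hhi hvlo hvhi honly using hvisits
  have hV : ∀ t < T.len, T.vert t ∈ G.vertexSet := fun t ht => (T.isLink t ht).left_mem
  let C : ChordDiagram α :=
    { len := T.len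
      vert := T.vert
      lo := lo
      hi := hi
      side := fun x => if x ∈ A then 1 else -1
      side_eq := fun x => by by_cases h : x ∈ A <;> simp [h]
      eq_lo_or_eq_hi := fun t ht => honly _ (hV t ht) t ht rfl
      lo_lt_hi := fun t ht => hlt _ (hV t ht)
      hi_lt := fun t ht => hhi _ (hV t ht)
      noncrossing := by
        intro s hs t ht hne hside
        have hint : ¬ T.Interlaced (T.vert s) (T.vert t) := by
          have hmem : ∀ r < T.len, T.vert r ∉ A → T.vert r ∈ B := fun r hr h => by
            have := hV r hr
            rw [← hAB] at this
            exact this.resolve_left h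
          by_cases h1 : T.vert s ∈ A
          · have h2 : T.vert t ∈ A := by
              by_contra h2
              simp only [if_pos h1, if_neg h2] at hside
              norm_num at hside
            exact hA _ h1 _ h2
          · have h2 : T.vert t ∉ A := by
              intro h2
              simp only [if_neg h1, if_pos h2] at hside
              norm_num at hside
            exact hB _ (hmem s hs h1) _ (hmem t ht h2)
        have hs' := hV s hs
        have ht' := hV t ht
        have hd : ∀ a b, T.vert a = T.vert s → T.vert b = T.vert t → a ≠ b := by
          rintro a b h1 h2 rfl
          exact hne (h1.symm.trans h2)
        have d1 := hd _ _ (hvlo _ hs') (hvlo _ ht')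
        have d2 := hd _ _ (hvlo _ hs') (hvhi _ ht')
        have d3 := hd _ _ (hvhi _ hs') (hvlo _ ht')
        have d4 := hd _ _ (hvhi _ hs') (hvhi _ ht')
        have l1 := hlt _ hs'
        have l2 := hlt _ ht'
        by_contra hcon
        have hcases : (lo (T.vert s) < lo (T.vert t) ∧ lo (T.vert t) < hi (T.vert s) ∧
            hi (T.vert s) < hi (T.vert t)) ∨ (lo (T.vert t) < lo (T.vert s) ∧
            lo (T.vert s) < hi (T.vert t) ∧ hi (T.vert t) < hi (T.vert s)) := by omega
        rcases hcases with ⟨c1, c2, c3⟩ | ⟨c1, c2, c3⟩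
        · exact hint ⟨hne, _, _, _, _, c1, c2, c3, hhi _ ht',
            Or.inl ⟨hvlo _ hs', hvlo _ ht', hvhi _ hs', hvhi _ ht'⟩⟩
        · exact hint ⟨hne, _, _, _, _, c1, c2, c3, hhi _ hs',
            Or.inr ⟨hvlo _ ht', hvlo _ hs', hvhi _ ht', hvhi _ hs'⟩⟩ }
  have hidx : ∀ e ∈ G.edgeSet, ∃ t, t < T.len ∧ T.edge t = e := fun e he => T.edge_bijOn.2.2 he
  choose! idx hidx1 hidx2 using hidx
  have hnext : ∀ t < T.len, T.vert (C.next t) = T.vert (t + 1) := by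
    intro t ht
    have ht' : t + 1 ≤ T.len := ht
    rcases ht'.lt_or_eq with h | h
    · have : C.next t = t + 1 := if_pos h
      rw [this]
    · have : C.next t = 0 := if_neg (by change ¬ t + 1 < T.len; omega)
      rw [this, h, T.closed]
  have hlen : ((4 : ℕ) : ℝ) = 4 := by norm_num
  refine ⟨{
    point := C.apex
    len := fun _ => 4
    node := fun e => C.node (idx e)
    point_injOn := ?_
    len_pos := fun _ _ => by norm_num
    joins := ?_
    edge_injOn := ?_
    edge_ne_point := ?_
    edge_ne_edge := ?_ }⟩
  · intro x hx y hy h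
    have hx' := (hlt x hx).trans (hhi x hx)
    have hy' := (hlt y hy).trans (hhi y hy)
    have one : (1 : ℝ) ∈ Set.Icc (0 : ℝ) 1 := by simp
    have := C.leg_inj hx' hy' (δ := 1) (δ' := 1) (Or.inl rfl) (Or.inl rfl) one one (by
      rw [C.leg_one, C.leg_one]
      change C.apex (T.vert _) = C.apex (T.vert _)
      rw [hvlo x hx, hvlo y hy, h])
    have h2 : T.vert (lo x) = T.vert (lo y) := this.1
    rwa [hvlo x hx, hvlo y hy] at h2
  · intro e he
    refine ⟨T.vert (idx e), T.vert (idx e + 1), ?_, rfl, ?_⟩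
    · have := T.isLink (idx e) (hidx1 e he)
      rwa [hidx2 e he] at this
    · rw [← hnext _ (hidx1 e he)]; rfl
  · intro e he u hu u' hu' h
    rw [hlen] at hu hu'
    exact (C.polyline_node_inj (hidx1 e he) (hidx1 e he) hu hu' h).2
  · intro e he x hx u hu h
    rw [hlen] at hu
    have hx' := (hlt x hx).trans (hhi x hx)
    refine C.polyline_node_ne_apex (hidx1 e he) hx' hu ?_
    change _ = C.apex (T.vert _)
    rw [hvlo x hx, h]
  · intro e he f hf hef u hu u' hu' h
    rw [hlen] at hu hu'
    have := (C.polyline_node_inj (hidx1 e he) (hidx1 f hf) hu hu' h).1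
    exact hef (by rw [← hidx2 e he, ← hidx2 f hf, this])

end EulerCycle

end Graph

theorem mainTheorem5 {α β : Type*} (G : Graph α β)
    (hV : G.vertexSet.Finite) (hE : G.edgeSet.Finite)
    (hconn : G.IsConnected) (hdeg : ∀ x ∈ G.vertexSet, G.degree x = 4) :
    G.IsPlanar ↔ ∃ T : G.EulerCycle, T.IsConvenient :=
  ⟨fun h => h.exists_isConvenient hV hE hconn hdeg,
    fun ⟨_, hT⟩ => hT.isPlanar hE hdeg⟩
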